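/- Let $\Omega=\{(m,k,l;n,r,t): m,n\in\mathbb{Z}_{\ge 0},\ k,l,r,t\in\mathbb{Z}\}$ and let $u=\{u_{m,k,l;n,r,t}\}_{(m,k,l;n,r,t)\in\Omega}$ be complex numbers. The extended two-dimensional moment problem asks for a non-negative Borel measure $\mu$ on $\mathbb{R}^2$ such that, for all $(m,k,l;n,r,t)\in\Omega$, the following integral converges absolutely and $$\int_{\mathbb{R}^2} x_1^m(x_1+i)^k(x_1-i)^l\,x_2^n(x_2+i)^r(x_2-i)^t\,d\mu = u_{m,k,l;n,r,t}.$$ (1) The problem has a solution if and only if the following two conditions hold. (a) Positivity: for every family $(\alpha_w)_{w\in\Omega}$ of complex numbers with only finitely many non-zero members, $$\sum_{(m,k,l;n,r,t),\,(m',k',l';n',r',t')\in\Omega}\alpha_{m,k,l;n,r,t}\,\overline{\alpha_{m',k',l';n',r',t'}}\;u_{m+m',\,k+l',\,l+k';\,n+n',\,r+t',\,t+r'}\ \ge 0 .$$ (b) Recurrences: for all $(m,k,l;n,r,t),(a,b,c;d,e,f)\in\Omega$, $$u_{m+1+a,k+c,l+b;n+d,r+f,t+e}+i\,u_{m+a,k+c,l+b;n+d,r+f,t+e}=u_{m+a,k+1+c,l+b;n+d,r+f,t+e},$$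 $$u_{m+1+a,k+c,l+b;n+d,r+f,t+e}-i\,u_{m+a,k+c,l+b;n+d,r+f,t+e}=u_{m+a,k+c,l+1+b;n+d,r+f,t+e},$$ $$u_{m+a,k+c,l+b;n+1+d,r+f,t+e}+i\,u_{m+a,k+c,l+b;n+d,r+f,t+e}=u_{m+a,k+c,l+b;n+d,r+1+f,t+e},$$ $$u_{m+a,k+c,l+b;n+1+d,r+f,t+e}-i\,u_{m+a,k+c,l+b;n+d,r+f,t+e}=u_{m+a,k+c,l+b;n+d,r+f,t+1+e}.$$ (2) If (a) and (b) hold, then the solution $\mu$ is unique and can be constructed as follows. There are a separable complex Hilbert space $H$ (scalar product linear in the first argument) and vectors $x_w\in H$, $w\in\Omega$, with closed linear span $H$, such that $$(x_{m,k,l;n,r,t},\,x_{m',k',l';n',r',t'})_H=u_{m+m',\,k+l',\,l+k';\,n+n',\,r+t',\,t+r'}$$ for all pairs of indices in $\Omega$. For any such $H$ and $(x_w)$, the linear operators $A_0,B_0$ with domain $\mathrm{Lin}\{x_w\}_{w\in\Omega}$ given by $$A_0\,x_{m,k,l;n,r,t}=x_{m+1,k,l;n,r,t},\qquad B_0\,x_{m,k,l;n,r,t}=x_{m,k,l;n+1,r,t}$$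 are well defined and closable, and their closures $A,B$ are self-adjoint and commute (that is, their spectral measures on $\mathbb{R}$ commute). There is a projection-valued spectral measure $E$ on the Borel sets of $\mathbb{R}^2$ with $A=\int x_1\,dE(x)$ and $B=\int x_2\,dE(x)$, and for any such $E$, $$\mu(\Delta)=(E(\Delta)\,x_{0,0,0;0,0,0},\,x_{0,0,0;0,0,0})_H\qquad\text{for all Borel sets }\Delta\subseteq\mathbb{R}^2 .$$ -/

import Mathlib

open MeasureTheory Complex
open scoped ComplexOrder ComplexConjugate

/-- The index set `Ω`: tuples `(m, k, l; n, r, t)` with `m, n` non-negative integers and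
`k, l, r, t` integers. -/
@[ext]
structure MomentIndex where
  m : ℕ
  k : ℤ
  l : ℤ
  n : ℕ
  r : ℤ
  t : ℤ

namespace MomentIndex

/-- The index `(0, 0, 0; 0, 0, 0)`. -/
def zero : MomentIndex := ⟨0, 0, 0, 0, 0, 0⟩

/-- The index `(m + m', k + l', l + k'; n + n', r + t', t + r')`. -/
def pair (w w' : MomentIndex) : MomentIndex :=
  ⟨w.m + w'.m, w.k + w'.l, w.l + w'.k, w.n + w'.n, w.r + w'.t, w.t + w'.r⟩

/-- The index with `m` raised by one. -/
def incM (w : MomentIndex) : MomentIndex := { w with m := w.m + 1 }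

/-- The index with `k` raised by one. -/
def incK (w : MomentIndex) : MomentIndex := { w with k := w.k + 1 }

/-- The index with `l` raised by one. -/
def incL (w : MomentIndex) : MomentIndex := { w with l := w.l + 1 }

/-- The index with `n` raised by one. -/
def incN (w : MomentIndex) : MomentIndex := { w with n := w.n + 1 }

/-- The index with `r` raised by one. -/
def incR (w : MomentIndex) : MomentIndex := { w with r := w.r + 1 }

/-- The index with `t` raised by one. -/
def incT (w : MomentIndex) : MomentIndex := { w with t := w.t + 1 }

/-- The function `x₁ᵐ (x₁ + i)ᵏ (x₁ - i)ˡ x₂ⁿ (x₂ + i)ʳ (x₂ - i)ᵗ` on the real plane. -/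
noncomputable def fn (w : MomentIndex) (p : ℝ × ℝ) : ℂ :=
  (p.1 : ℂ) ^ w.m * ((p.1 : ℂ) + I) ^ w.k * ((p.1 : ℂ) - I) ^ w.l *
    ((p.2 : ℂ) ^ w.n * ((p.2 : ℂ) + I) ^ w.r * ((p.2 : ℂ) - I) ^ w.t)

end MomentIndex

/-- The (non-negative Borel) measure `μ` on the plane solves the extended two-dimensional moment
problem with data `u`: all the integrals exist and have the prescribed values. -/
def IsMomentSolution (u : MomentIndex → ℂ) (μ : Measure (ℝ × ℝ)) : Prop :=
  ∀ w : MomentIndex, Integrable w.fn μ ∧ ∫ p, w.fn p ∂μ = u w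

/-- The positivity condition, for all finitely supported families of complex coefficients.
(`0 ≤ z` for a complex number `z` says that `z` is real and non-negative.) -/
def MomentPositive (u : MomentIndex → ℂ) : Prop :=
  ∀ α : MomentIndex →₀ ℂ,
    0 ≤ ∑ w ∈ α.support, ∑ w' ∈ α.support, α w * conj (α w') * u (w.pair w')

/-- The four linear recurrence relations. -/
structure MomentRecurrences (u : MomentIndex → ℂ) : Prop where
  rec_k : ∀ w v : MomentIndex, u (w.incM.pair v) + I * u (w.pair v) = u (w.incK.pair v)
  rec_l : ∀ w v : MomentIndex, u (w.incM.pair v) - I * u (w.pair v) = u (w.incL.pair v)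
  rec_r : ∀ w v : MomentIndex, u (w.incN.pair v) + I * u (w.pair v) = u (w.incR.pair v)
  rec_t : ∀ w v : MomentIndex, u (w.incN.pair v) - I * u (w.pair v) = u (w.incT.pair v)

/-- An orthogonal operator spectral measure on the measurable sets of `X`: a strongly countably
additive family of orthogonal projections of the Hilbert space `H`, equal to the identity on the
whole space. The values on non-measurable sets carry no meaning. -/
structure SpectralMeasure (X : Type*) [MeasurableSpace X] (H : Type*) [NormedAddCommGroup H]
    [InnerProductSpace ℂ H] [CompleteSpace H] where
  proj : Set X → H →L[ℂ] H
  isStarProjection : ∀ S, MeasurableSet S → IsStarProjection (proj S)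
  proj_univ : proj Set.univ = 1
  proj_inter : ∀ S T, MeasurableSet S → MeasurableSet T → proj (S ∩ T) = proj S * proj T
  hasSum_iUnion : ∀ S : ℕ → Set X, (∀ j, MeasurableSet (S j)) →
    Pairwise (Function.onFun Disjoint S) →
    ∀ h : H, HasSum (fun j => proj (S j) h) (proj (⋃ j, S j) h)

namespace SpectralMeasure

variable {X : Type*} [MeasurableSpace X] {H : Type*} [NormedAddCommGroup H]
  [InnerProductSpace ℂ H] [CompleteSpace H]

theorem proj_empty (E : SpectralMeasure X H) : E.proj ∅ = 0 := by
  ext h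
  have hs := E.hasSum_iUnion (fun _ => ∅) (fun _ => MeasurableSet.empty)
    (fun _ _ _ => by simp [Function.onFun]) h
  have := hs.summable.tendsto_atTop_zero
  simpa using tendsto_nhds_unique tendsto_const_nhds this

theorem re_inner_eq (E : SpectralMeasure X H) (h : H) {S : Set X} (hS : MeasurableSet S) :
    (inner ℂ h (E.proj S h)).re = ‖E.proj S h‖ ^ 2 := by
  have hp := E.isStarProjection S hS
  have h1 : E.proj S (E.proj S h) = E.proj S h := by
    have := congrArg (fun T : H →L[ℂ] H => T h) hp.isIdempotentElem.eq
    simpa using this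
  have h2 : ContinuousLinearMap.adjoint (E.proj S) = E.proj S := hp.isSelfAdjoint.star_eq
  have h3 : inner ℂ h (E.proj S h) = inner ℂ (E.proj S h) (E.proj S h) := by
    conv_lhs => rw [← h1]
    rw [← ContinuousLinearMap.adjoint_inner_left, h2]
  rw [h3, inner_self_eq_norm_sq_to_K]
  norm_cast

/-- The non-negative scalar measure `S ↦ (E(S) h, h)`. -/
noncomputable def scalarMeasure (E : SpectralMeasure X H) (h : H) : Measure X :=
  Measure.ofMeasurable (fun S _ => ENNReal.ofReal (inner ℂ h (E.proj S h)).re)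
    (by simp [proj_empty])
    (by
      intro S hS hd
      have hs := E.hasSum_iUnion S hS hd h
      have h1 : HasSum (fun j => (inner ℂ h (E.proj (S j) h)).re)
          (inner ℂ h (E.proj (⋃ j, S j) h)).re :=
        Complex.hasSum_re (hs.mapL (innerSL ℂ h))
      change ENNReal.ofReal _ = ∑' j, ENNReal.ofReal _
      rw [← ENNReal.ofReal_tsum_of_nonneg _ h1.summable, h1.tsum_eq]
      intro j
      rw [re_inner_eq E h (hS j)]
      positivity)

/-- `A = ∫ f dE` for a real function `f` (with `A` possibly unbounded): the domain of `A` consists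
of all `h` for which `∫ f² d(E h, h)` is finite, and `(A h, h) = ∫ f d(E h, h)` for these `h`.
By polarization the latter determines `(A h, g)` for all `h`, `g` in the domain. -/
def IsIntegral (E : SpectralMeasure X H) (f : X → ℝ) (A : H →ₗ.[ℂ] H) : Prop :=
  (∀ h : H, h ∈ A.domain ↔ MemLp f 2 (E.scalarMeasure h)) ∧
  ∀ h : A.domain, inner ℂ (h : H) (A h) = ((∫ p, f p ∂(E.scalarMeasure (h : H)) : ℝ) : ℂ)

end SpectralMeasure

section Operators

variable {H : Type*} [NormedAddCommGroup H] [InnerProductSpace ℂ H]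

/-- A family of vectors representing `u`: `(x_w, x_w') = u_{w.pair w'}` for all `w`, `w'`, with
closed linear span equal to `H`. The scalar product `(a, b)`, linear in `a`, is `inner ℂ b a`. -/
def IsRepresentingFamily (u : MomentIndex → ℂ) (x : MomentIndex → H) : Prop :=
  (∀ w w' : MomentIndex, inner ℂ (x w') (x w) = u (w.pair w')) ∧
  (Submodule.span ℂ (Set.range x)).topologicalClosure = ⊤

/-- `T` is the operator with domain `Lin {x_w}` acting by `∑ α_w x_w ↦ ∑ α_w x_{σ w}` (finite
sums). -/
def IsShiftOperator (x : MomentIndex → H) (σ : MomentIndex → MomentIndex) (T : H →ₗ.[ℂ] H) :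
    Prop :=
  T.graph = Submodule.span ℂ (Set.range fun w => (x w, x (σ w)))

/-- Two self-adjoint operators commute: their spectral measures on the line commute. -/
def SpectrallyCommute [CompleteSpace H] (A B : H →ₗ.[ℂ] H) : Prop :=
  ∃ EA EB : SpectralMeasure ℝ H, EA.IsIntegral (fun s => s) A ∧ EB.IsIntegral (fun s => s) B ∧
    ∀ S T : Set ℝ, MeasurableSet S → MeasurableSet T → Commute (EA.proj S) (EB.proj T)

/-- `E` is a joint spectral measure of `A` and `B`: `A = ∫ x₁ dE` and `B = ∫ x₂ dE`. -/
def IsJointSpectralMeasure [CompleteSpace H] (E : SpectralMeasure (ℝ × ℝ) H)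
    (A B : H →ₗ.[ℂ] H) : Prop :=
  E.IsIntegral Prod.fst A ∧ E.IsIntegral Prod.snd B

end Operators

/-! Necessity is direct: the positivity sum equals `∫ |∑ α_w fn w|² dμ`, and the recurrences are
pointwise identities between the functions `fn w`. Determinacy holds because the bounded functions
in the span of the `fn w` form a star algebra containing `(x₁ + i)⁻¹` and `(x₂ + i)⁻¹`. It separates
points, so its integrals determine a finite measure. The same argument makes the `fn w` total in
`L²(μ)` (`topologicalClosure_span_toLp`).

For sufficiency, positivity gives a Hilbert space with vectors `x_w`. By the recurrences, raising
`k` and raising `l` act on the `x_w` as `A₀ + i` and `A₀ - i`; these two families have equal Gram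
matrices and are total, because the exponents run through all of `ℤ`. Hence the Cayley transform is
unitary, and `(A + i)⁻¹` is a bounded normal operator `S₁` (`exists_isShiftResolvent`); likewise
`S₂` for `B`. This yields closability and self-adjointness. The operators `S₁`, `S₂` and their
adjoints commute, so Gelfand duality and the Riesz representation theorem turn vector states into
measures in the variables `zⱼ = (xⱼ + i)⁻¹` (`exists_inverseModel`). Substituting `xⱼ = Re zⱼ⁻¹`
gives a solution on the plane (`InverseModel.isMomentSolution`).

The joint spectral measure comes from the solution: since the `fn w` are total, any representing
Hilbert space is unitarily equivalent to `L²(μ)`, where `A` and `B` become multiplication by the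
coordinates. Conversely, for any joint spectral measure, `x_w` is the spectral integral of `fn w`
applied to `x_0` (`represents_fn`). Therefore `(E x_0, x_0)` solves the moment problem and equals
`μ` by determinacy. -/

namespace MomentIndex

/-! ### The algebra of the functions `fn w` and its bounded part. -/

/-- Componentwise sum of indices. -/
def add (w v : MomentIndex) : MomentIndex :=
  ⟨w.m + v.m, w.k + v.k, w.l + v.l, w.n + v.n, w.r + v.r, w.t + v.t⟩

/-- The index of the complex conjugate function. -/
def conjIndex (w : MomentIndex) : MomentIndex := ⟨w.m, w.l, w.k, w.n, w.t, w.r⟩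

theorem ofReal_add_I_ne_zero (s : ℝ) : (s : ℂ) + I ≠ 0 := fun h => by
  simpa using congrArg Complex.im h

theorem ofReal_sub_I_ne_zero (s : ℝ) : (s : ℂ) - I ≠ 0 := fun h => by
  simpa using congrArg Complex.im h

theorem fn_add (w v : MomentIndex) (p : ℝ × ℝ) : (w.add v).fn p = w.fn p * v.fn p := by
  simp only [fn, add, pow_add, zpow_add₀ (ofReal_add_I_ne_zero _),
    zpow_add₀ (ofReal_sub_I_ne_zero _)]
  ring

theorem fn_conjIndex (w : MomentIndex) (p : ℝ × ℝ) : w.conjIndex.fn p = conj (w.fn p) := by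
  simp only [fn, conjIndex, map_mul, map_pow, map_zpow₀, map_add, map_sub, conj_ofReal, conj_I,
    sub_neg_eq_add, ← sub_eq_add_neg]
  ring

theorem fn_pair (w v : MomentIndex) (p : ℝ × ℝ) :
    (w.pair v).fn p = w.fn p * conj (v.fn p) := by
  rw [← fn_conjIndex, ← fn_add]; rfl

theorem fn_zero (p : ℝ × ℝ) : zero.fn p = 1 := by simp [fn, zero]

theorem fn_incM (w : MomentIndex) (p : ℝ × ℝ) : w.incM.fn p = p.1 * w.fn p := by
  simp only [fn, incM, pow_succ]; ring

theorem fn_incN (w : MomentIndex) (p : ℝ × ℝ) : w.incN.fn p = p.2 * w.fn p := by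
  simp only [fn, incN, pow_succ]; ring

theorem fn_incK (w : MomentIndex) (p : ℝ × ℝ) : w.incK.fn p = (p.1 + I) * w.fn p := by
  simp only [fn, incK, zpow_add_one₀ (ofReal_add_I_ne_zero _)]; ring

theorem fn_incL (w : MomentIndex) (p : ℝ × ℝ) : w.incL.fn p = (p.1 - I) * w.fn p := by
  simp only [fn, incL, zpow_add_one₀ (ofReal_sub_I_ne_zero _)]; ring

theorem fn_incR (w : MomentIndex) (p : ℝ × ℝ) : w.incR.fn p = (p.2 + I) * w.fn p := by
  simp only [fn, incR, zpow_add_one₀ (ofReal_add_I_ne_zero _)]; ring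

theorem fn_incT (w : MomentIndex) (p : ℝ × ℝ) : w.incT.fn p = (p.2 - I) * w.fn p := by
  simp only [fn, incT, zpow_add_one₀ (ofReal_sub_I_ne_zero _)]; ring

theorem continuous_fn (w : MomentIndex) : Continuous w.fn := by
  unfold fn
  have h1 : Continuous fun p : ℝ × ℝ => ((p.1 : ℂ) + I) ^ w.k :=
    (by fun_prop : Continuous fun p : ℝ × ℝ => (p.1 : ℂ) + I).zpow₀ _
      fun p => Or.inl (ofReal_add_I_ne_zero _)
  have h2 : Continuous fun p : ℝ × ℝ => ((p.1 : ℂ) - I) ^ w.l :=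
    (by fun_prop : Continuous fun p : ℝ × ℝ => (p.1 : ℂ) - I).zpow₀ _
      fun p => Or.inl (ofReal_sub_I_ne_zero _)
  have h3 : Continuous fun p : ℝ × ℝ => ((p.2 : ℂ) + I) ^ w.r :=
    (by fun_prop : Continuous fun p : ℝ × ℝ => (p.2 : ℂ) + I).zpow₀ _
      fun p => Or.inl (ofReal_add_I_ne_zero _)
  have h4 : Continuous fun p : ℝ × ℝ => ((p.2 : ℂ) - I) ^ w.t :=
    (by fun_prop : Continuous fun p : ℝ × ℝ => (p.2 : ℂ) - I).zpow₀ _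
      fun p => Or.inl (ofReal_sub_I_ne_zero _)
  fun_prop

/-- The complex linear span of the functions `fn w`. -/
def fnSpan : Submodule ℂ (ℝ × ℝ → ℂ) := Submodule.span ℂ (Set.range fn)

theorem fn_mem_fnSpan (w : MomentIndex) : w.fn ∈ fnSpan := Submodule.subset_span ⟨w, rfl⟩

theorem mul_mem_fnSpan {f g : ℝ × ℝ → ℂ} (hf : f ∈ fnSpan) (hg : g ∈ fnSpan) :
    f * g ∈ fnSpan := by
  have h := Submodule.mul_mem_mul hf hg
  rw [fnSpan, Submodule.span_mul_span] at h
  refine Submodule.span_mono ?_ h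
  rintro _ ⟨_, ⟨w, rfl⟩, _, ⟨v, rfl⟩, rfl⟩
  exact ⟨w.add v, funext fun p => fn_add w v p⟩

theorem star_mem_fnSpan {f : ℝ × ℝ → ℂ} (hf : f ∈ fnSpan) : star f ∈ fnSpan := by
  induction hf using Submodule.span_induction with
  | mem f hf =>
    obtain ⟨w, rfl⟩ := hf
    exact Submodule.subset_span ⟨w.conjIndex, funext fun p => fn_conjIndex w p⟩
  | zero => simp
  | add f g _ _ hf hg => rw [star_add]; exact add_mem hf hg
  | smul a f _ hf => rw [star_smul]; exact Submodule.smul_mem _ _ hf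

/-- The star subalgebra of all bounded elements of the span of the functions `fn w`. -/
def boundedFn : StarSubalgebra ℂ (BoundedContinuousFunction (ℝ × ℝ) ℂ) where
  carrier := {g | ⇑g ∈ fnSpan}
  mul_mem' {f g} hf hg := by
    simpa using mul_mem_fnSpan hf hg
  one_mem' := by
    have : (⇑(1 : BoundedContinuousFunction (ℝ × ℝ) ℂ)) = zero.fn := by
      ext p; simp [fn_zero]
    simpa [this] using fn_mem_fnSpan zero
  add_mem' {f g} hf hg := by simpa using add_mem hf hg
  zero_mem' := by simp
  algebraMap_mem' c := by
    have : (⇑(algebraMap ℂ (BoundedContinuousFunction (ℝ × ℝ) ℂ) c)) = c • zero.fn := by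
      ext p; simp [fn_zero]
    simpa [this] using Submodule.smul_mem _ c (fn_mem_fnSpan zero)
  star_mem' {f} hf := by simpa using star_mem_fnSpan hf

theorem one_le_norm_ofReal_add_I (s : ℝ) : 1 ≤ ‖(s : ℂ) + I‖ := by
  simpa using Complex.abs_im_le_norm ((s : ℂ) + I)

theorem norm_inv_ofReal_add_I_le (s : ℝ) : ‖((s : ℂ) + I)⁻¹‖ ≤ 1 := by
  rw [norm_inv]; exact inv_le_one_of_one_le₀ (one_le_norm_ofReal_add_I s)

/-- The functions `(x₁ + i)⁻¹` and `(x₂ + i)⁻¹` are bounded by 1, and each is injective in its own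
coordinate. -/
theorem boundedFn_separatesPoints :
    (boundedFn.map (BoundedContinuousFunction.toContinuousMapStarₐ ℂ)).SeparatesPoints := by
  have key : ∀ w : MomentIndex, (∀ p, ‖w.fn p‖ ≤ 1) → ∀ p q : ℝ × ℝ, w.fn p ≠ w.fn q →
      ∃ f ∈ ((fun f : C(ℝ × ℝ, ℂ) => (f : ℝ × ℝ → ℂ)) ''
        (boundedFn.map (BoundedContinuousFunction.toContinuousMapStarₐ ℂ) : Set C(ℝ × ℝ, ℂ))),
        f p ≠ f q := by
    intro w hw p q hpq
    let g := BoundedContinuousFunction.ofNormedAddCommGroup w.fn w.continuous_fn 1 hw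
    exact ⟨w.fn, ⟨(g : C(ℝ × ℝ, ℂ)), ⟨g, fn_mem_fnSpan w, rfl⟩, rfl⟩, hpq⟩
  intro p q hpq
  by_cases h : p.1 = q.1
  · have h2 : p.2 ≠ q.2 := fun h2 => hpq (Prod.ext h h2)
    refine key ⟨0, 0, 0, 0, -1, 0⟩ (fun p => by simpa [fn] using norm_inv_ofReal_add_I_le p.2) p q ?_
    simpa [fn] using h2
  · refine key ⟨0, -1, 0, 0, 0, 0⟩ (fun p => by simpa [fn] using norm_inv_ofReal_add_I_le p.1) p q ?_
    simpa [fn] using h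

theorem measure_ext_of_integral_boundedFn {P P' : Measure (ℝ × ℝ)} [IsFiniteMeasure P]
    [IsFiniteMeasure P'] (h : ∀ g ∈ boundedFn, ∫ p, g p ∂P = ∫ p, g p ∂P') : P = P' :=
  ext_of_forall_mem_subalgebra_integral_eq_of_polish boundedFn_separatesPoints h

end MomentIndex

open MomentIndex

/-! ### Determinacy, necessity, and density in `L²(μ)`. -/

namespace IsMomentSolution

variable {u : MomentIndex → ℂ} {μ : Measure (ℝ × ℝ)}

theorem isFiniteMeasure (h : IsMomentSolution u μ) : IsFiniteMeasure μ := by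
  have h1 : Integrable (fun _ : ℝ × ℝ => (1 : ℂ)) μ := by
    simpa [funext fn_zero] using (h zero).1
  exact (integrable_const_iff_isFiniteMeasure one_ne_zero).1 h1

theorem integrable_of_mem (h : IsMomentSolution u μ) {f : ℝ × ℝ → ℂ} (hf : f ∈ fnSpan) :
    Integrable f μ := by
  induction hf using Submodule.span_induction with
  | mem f hf => obtain ⟨w, rfl⟩ := hf; exact (h w).1
  | zero => exact integrable_zero _ _ _
  | add f g _ _ hf hg => exact hf.add hg
  | smul a f _ hf => exact hf.smul a

theorem integral_eq_of_mem (h : IsMomentSolution u μ) {μ' : Measure (ℝ × ℝ)}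
    (h' : IsMomentSolution u μ') {f : ℝ × ℝ → ℂ} (hf : f ∈ fnSpan) :
    ∫ p, f p ∂μ = ∫ p, f p ∂μ' := by
  induction hf using Submodule.span_induction with
  | mem f hf => obtain ⟨w, rfl⟩ := hf; rw [(h w).2, (h' w).2]
  | zero => simp
  | add f g hf' hg' hf hg =>
    simp only [Pi.add_apply]
    rw [integral_add (h.integrable_of_mem hf') (h.integrable_of_mem hg'),
      integral_add (h'.integrable_of_mem hf') (h'.integrable_of_mem hg'), hf, hg]
  | smul a f _ hf => simp only [Pi.smul_apply, integral_smul, hf]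

/-- The extended moment problem is determinate. -/
theorem unique (h : IsMomentSolution u μ) {μ' : Measure (ℝ × ℝ)} (h' : IsMomentSolution u μ') :
    μ = μ' := by
  have := h.isFiniteMeasure
  have := h'.isFiniteMeasure
  exact measure_ext_of_integral_boundedFn fun g hg => h.integral_eq_of_mem h' hg

theorem momentRecurrences (h : IsMomentSolution u μ) : MomentRecurrences u := by
  have key : ∀ a b c : MomentIndex, ∀ z : ℂ, (∀ p, a.fn p + z * b.fn p = c.fn p) →
      u a + z * u b = u c := by
    intro a b c z hp
    rw [← (h a).2, ← (h b).2, ← (h c).2, ← integral_const_mul,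
      ← integral_add (h a).1 ((h b).1.const_mul z)]
    exact integral_congr_ae (.of_forall hp)
  constructor <;> intro w v
  · refine key _ _ _ _ fun p => ?_
    rw [fn_pair, fn_pair, fn_pair, fn_incM, fn_incK]; ring
  · have := key (w.incM.pair v) (w.pair v) (w.incL.pair v) (-I) fun p => by
      rw [fn_pair, fn_pair, fn_pair, fn_incM, fn_incL]; ring
    rw [← this]; ring
  · refine key _ _ _ _ fun p => ?_
    rw [fn_pair, fn_pair, fn_pair, fn_incN, fn_incR]; ring
  · have := key (w.incN.pair v) (w.pair v) (w.incT.pair v) (-I) fun p => by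
      rw [fn_pair, fn_pair, fn_pair, fn_incN, fn_incT]; ring
    rw [← this]; ring

/-- Since `fn (w.pair w') = fn w * conj (fn w')`, the double sum is the integral of `|∑ α_w fn w|²`.
-/
theorem momentPositive (h : IsMomentSolution u μ) : MomentPositive u := by
  intro α
  have h1 : ∑ w ∈ α.support, ∑ w' ∈ α.support, α w * conj (α w') * u (w.pair w') =
      ∫ p, ((‖∑ w ∈ α.support, α w * w.fn p‖ ^ 2 : ℝ) : ℂ) ∂μ := by
    have h2 : ∀ p, ((‖∑ w ∈ α.support, α w * w.fn p‖ ^ 2 : ℝ) : ℂ) =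
        ∑ w ∈ α.support, ∑ w' ∈ α.support, α w * conj (α w') * (w.pair w').fn p := by
      intro p
      rw [Complex.ofReal_pow, ← Complex.mul_conj', map_sum, Finset.sum_mul_sum]
      refine Finset.sum_congr rfl fun w _ => Finset.sum_congr rfl fun w' _ => ?_
      rw [fn_pair, map_mul]; ring
    simp only [h2]
    rw [integral_finsetSum _ fun w _ => integrable_finsetSum _ fun w' _ => (h _).1.const_mul _]
    refine Finset.sum_congr rfl fun w _ => ?_
    rw [integral_finsetSum _ fun w' _ => (h _).1.const_mul _]
    refine Finset.sum_congr rfl fun w' _ => ?_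
    rw [integral_const_mul, (h _).2]
  rw [h1, integral_complex_ofReal, Complex.zero_le_real]
  exact integral_nonneg fun p => by positivity

theorem memLp_fn (h : IsMomentSolution u μ) (w : MomentIndex) : MemLp w.fn 2 μ := by
  rw [memLp_two_iff_integrable_sq_norm w.continuous_fn.aestronglyMeasurable]
  refine ((h (w.pair w)).1.norm).congr (.of_forall fun p => ?_)
  simp only [fn_pair, norm_mul, RCLike.norm_conj]; ring

/-- A real function in `L¹(μ)` orthogonal to all bounded elements of the span vanishes. -/
theorem ae_eq_zero_of_integral_mul (h : IsMomentSolution u μ) {φ : ℝ × ℝ → ℝ}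
    (hφ : Integrable φ μ) (h0 : ∀ g ∈ boundedFn, ∫ p, (φ p : ℂ) * g p ∂μ = 0) : φ =ᵐ[μ] 0 := by
  have := h.isFiniteMeasure
  have hm : ∀ {ψ : ℝ × ℝ → ℝ}, Integrable ψ μ → AEMeasurable (fun p => ENNReal.ofReal (ψ p)) μ :=
    fun hψ => hψ.1.aemeasurable.ennreal_ofReal
  have hfin : ∀ {ψ : ℝ × ℝ → ℝ}, Integrable ψ μ → ∫⁻ p, ENNReal.ofReal (ψ p) ∂μ ≠ ⊤ := by
    intro ψ hψ
    refine (lt_of_le_of_lt (lintegral_mono fun p => ?_) hψ.2).ne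
    rw [← Real.enorm_abs, Real.enorm_of_nonneg (abs_nonneg _)]
    exact ENNReal.ofReal_le_ofReal (le_abs_self _)
  have : IsFiniteMeasure (μ.withDensity fun p => ENNReal.ofReal (φ p)) :=
    isFiniteMeasure_withDensity (hfin hφ)
  have : IsFiniteMeasure (μ.withDensity fun p => ENNReal.ofReal (-φ p)) :=
    isFiniteMeasure_withDensity (hfin hφ.neg)
  have hφ' : Integrable (fun p => -φ p) μ := hφ.neg
  -- The positive and negative parts of `φ` are densities of two finite measures that agree on the
  -- separating algebra, hence coincide.
  have heq : (μ.withDensity fun p => ENNReal.ofReal (φ p)) =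
      μ.withDensity fun p => ENNReal.ofReal (-φ p) := by
    refine measure_ext_of_integral_boundedFn fun g hg => ?_
    have hI : ∀ {ψ : ℝ × ℝ → ℝ}, Integrable ψ μ →
        Integrable (fun p => (ENNReal.ofReal (ψ p)).toReal • g p) μ := by
      intro ψ hψ
      refine (hψ.norm.mul_const ‖g‖).mono' ((hm hψ).ennreal_toReal.aestronglyMeasurable.smul
        g.continuous.aestronglyMeasurable) (.of_forall fun p => ?_)
      rw [norm_smul, ENNReal.toReal_ofReal', Real.norm_of_nonneg (le_max_right _ _)]
      exact mul_le_mul (max_le (le_abs_self _) (abs_nonneg _)) (g.norm_coe_le_norm p)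
        (norm_nonneg _) (abs_nonneg _)
    rw [integral_withDensity_eq_integral_toReal_smul₀ (hm hφ)
        (.of_forall fun _ => ENNReal.ofReal_lt_top),
      integral_withDensity_eq_integral_toReal_smul₀ (hm hφ')
        (.of_forall fun _ => ENNReal.ofReal_lt_top), ← sub_eq_zero, ← integral_sub (hI hφ)
        (hI hφ'), ← h0 g hg]
    refine integral_congr_ae (.of_forall fun p => ?_)
    simp only [ENNReal.toReal_ofReal', Complex.real_smul]
    rw [← sub_mul, ← Complex.ofReal_sub, max_zero_sub_eq_self]
  have h1 := (withDensity_eq_iff (hm hφ) (hm hφ') (hfin hφ)).1 heq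
  filter_upwards [h1] with p hp
  have h2 := congrArg ENNReal.toReal hp
  simp only [ENNReal.toReal_ofReal'] at h2
  simpa [h2] using (max_zero_sub_eq_self (φ p)).symm

theorem memLp_of_mem (h : IsMomentSolution u μ) {f : ℝ × ℝ → ℂ} (hf : f ∈ fnSpan) :
    MemLp f 2 μ := by
  induction hf using Submodule.span_induction with
  | mem f hf => obtain ⟨w, rfl⟩ := hf; exact h.memLp_fn w
  | zero => exact MemLp.zero'
  | add f g _ _ hf hg => exact hf.add hg
  | smul a f _ hf => exact hf.const_smul a

/-- The span is closed under conjugation, so `f` and `conj f` both annihilate the bounded functions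
in it; the real part then does too and falls under the real-valued criterion. -/
theorem re_ae_eq_zero (h : IsMomentSolution u μ) {f : ℝ × ℝ → ℂ} (hf : MemLp f 2 μ)
    (h0 : ∀ w : MomentIndex, ∫ p, w.fn p * f p ∂μ = 0) : (fun p => (f p).re) =ᵐ[μ] 0 := by
  have := h.isFiniteMeasure
  have h1 : ∀ g ∈ fnSpan, ∫ p, g p * f p ∂μ = 0 := by
    intro g hg
    induction hg using Submodule.span_induction with
    | mem f hf => obtain ⟨w, rfl⟩ := hf; exact h0 w
    | zero => simp
    | add a b ha hb ha' hb' =>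
      have ia : Integrable (fun p => a p * f p) μ := (h.memLp_of_mem ha).integrable_mul hf
      have ib : Integrable (fun p => b p * f p) μ := (h.memLp_of_mem hb).integrable_mul hf
      simp only [Pi.add_apply, add_mul]
      rw [integral_add ia ib, ha', hb', add_zero]
    | smul a g _ hg => simp only [Pi.smul_apply, smul_mul_assoc, integral_smul, hg, smul_zero]
  refine h.ae_eq_zero_of_integral_mul (hf.integrable one_le_two).re fun g hg => ?_
  have hg1 : Integrable (fun p => g p * f p) μ := (h.memLp_of_mem hg).integrable_mul hf
  have hg2 : Integrable (fun p => conj ((star ⇑g) p * f p)) μ :=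
    (LinearIsometryEquiv.integrable_comp_iff conjLIE).2
      ((h.memLp_of_mem (star_mem_fnSpan hg)).integrable_mul hf)
  have h2 : ∫ p, conj ((star ⇑g) p * f p) ∂μ = 0 := by
    rw [integral_conj, h1 _ (star_mem_fnSpan hg), map_zero]
  have h3 : ∫ p, (g p * f p + conj ((star ⇑g) p * f p)) ∂μ = 0 := by
    rw [integral_add hg1 hg2, h2, h1 _ hg, add_zero]
  have h4 : ∀ p, ((f p).re : ℂ) * g p = 2⁻¹ * (g p * f p + conj ((star ⇑g) p * f p)) := by
    intro p
    simp only [Pi.star_apply, map_mul, RCLike.star_def, Complex.conj_conj, Complex.re_eq_add_conj]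
    ring
  simp only [h4]
  rw [integral_const_mul, h3, mul_zero]

/-- The functions `fn w` are total in `L²(μ)`. -/
theorem topologicalClosure_span_toLp (h : IsMomentSolution u μ) :
    (Submodule.span ℂ (Set.range fun w => (h.memLp_fn w).toLp)).topologicalClosure = ⊤ := by
  rw [Submodule.topologicalClosure_eq_top_iff, Submodule.eq_bot_iff]
  intro f hf
  have h0 : ∀ w : MomentIndex, ∫ p, w.fn p * f p ∂μ = 0 := by
    intro w
    have h1 := (Submodule.mem_orthogonal _ _).1 hf _ (Submodule.subset_span ⟨w.conjIndex, rfl⟩)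
    rw [L2.inner_def] at h1
    rw [← h1]
    refine integral_congr_ae ?_
    filter_upwards [(h.memLp_fn w.conjIndex).coeFn_toLp] with p hp
    rw [hp, fn_conjIndex]
    simp [mul_comm]
  have h1 := h.re_ae_eq_zero (Lp.memLp f) h0
  -- The real part of `I * f` is minus the imaginary part of `f`.
  have h2 := h.re_ae_eq_zero ((Lp.memLp f).const_mul I) fun w => by
    simp only [mul_left_comm _ I]
    rw [integral_const_mul, h0, mul_zero]
  refine Lp.eq_zero_iff_ae_eq_zero.2 ?_
  filter_upwards [h1, h2] with p hp1 hp2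
  refine Complex.ext hp1 ?_
  simpa using hp2

theorem inner_toLp (h : IsMomentSolution u μ) (w w' : MomentIndex) :
    inner ℂ (h.memLp_fn w').toLp (h.memLp_fn w).toLp = u (w.pair w') := by
  rw [L2.inner_def, ← (h (w.pair w')).2]
  refine integral_congr_ae ?_
  filter_upwards [(h.memLp_fn w).coeFn_toLp, (h.memLp_fn w').coeFn_toLp] with p hp hp'
  rw [hp, hp', fn_pair]
  rfl

end IsMomentSolution

/-! ### Families of vectors with equal Gram matrices. -/

section Gram

variable {ι H K : Type*} [NormedAddCommGroup H] [InnerProductSpace ℂ H]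
  [NormedAddCommGroup K] [InnerProductSpace ℂ K]

theorem denseRange_linearCombination {x : ι → H}
    (hx : (Submodule.span ℂ (Set.range x)).topologicalClosure = ⊤) :
    DenseRange (Finsupp.linearCombination ℂ x) := by
  have h := Submodule.dense_iff_topologicalClosure_eq_top.2 hx
  rw [← Finsupp.range_linearCombination] at h
  rwa [DenseRange, ← LinearMap.coe_range]

theorem inner_linearCombination_eq {x : ι → H} {y : ι → K}
    (h : ∀ i j, inner ℂ (y i) (y j) = inner ℂ (x i) (x j)) (a b : ι →₀ ℂ) :
    inner ℂ (Finsupp.linearCombination ℂ y a) (Finsupp.linearCombination ℂ y b) =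
      inner ℂ (Finsupp.linearCombination ℂ x a) (Finsupp.linearCombination ℂ x b) := by
  simp only [Finsupp.linearCombination_apply, Finsupp.sum_inner, Finsupp.inner_sum,
    inner_smul_left, inner_smul_right, h]

/-- Two families of vectors with the same Gram matrix, the first of which is total, are related by
a linear isometry. -/
theorem exists_linearIsometry_of_inner_eq [CompleteSpace K] {x : ι → H} {y : ι → K}
    (hx : (Submodule.span ℂ (Set.range x)).topologicalClosure = ⊤)
    (h : ∀ i j, inner ℂ (y i) (y j) = inner ℂ (x i) (x j)) :
    ∃ V : H →ₗᵢ[ℂ] K, ∀ i, V (x i) = y i := by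
  have hd := denseRange_linearCombination hx
  have hn : ∀ a, ‖Finsupp.linearCombination ℂ y a‖ = ‖Finsupp.linearCombination ℂ x a‖ := by
    intro a
    rw [@norm_eq_sqrt_re_inner ℂ, @norm_eq_sqrt_re_inner ℂ, inner_linearCombination_eq h]
  -- Equality of norms makes the map well defined on linear combinations, even when the `x i` are
  -- linearly dependent.
  let V := (Finsupp.linearCombination ℂ y).extendOfNorm (Finsupp.linearCombination ℂ x)
  have hV : ∀ a, V (Finsupp.linearCombination ℂ x a) = Finsupp.linearCombination ℂ y a :=
    LinearMap.extendOfNorm_eq hd ⟨1, fun a => by rw [one_mul, hn]⟩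
  refine ⟨⟨V.toLinearMap, fun z => ?_⟩, fun i => ?_⟩
  · refine hd.induction_on (p := fun z => ‖V z‖ = ‖z‖) z
      (isClosed_eq (by fun_prop) (by fun_prop)) fun a => ?_
    rw [hV, hn]
  · simpa using hV (Finsupp.single i 1)

/-- Two total families of vectors with the same Gram matrix are unitarily equivalent. -/
theorem exists_linearIsometryEquiv_of_inner_eq [CompleteSpace H] [CompleteSpace K]
    {x : ι → H} {y : ι → K}
    (hx : (Submodule.span ℂ (Set.range x)).topologicalClosure = ⊤)
    (hy : (Submodule.span ℂ (Set.range y)).topologicalClosure = ⊤)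
    (h : ∀ i j, inner ℂ (y i) (y j) = inner ℂ (x i) (x j)) :
    ∃ V : H ≃ₗᵢ[ℂ] K, ∀ i, V (x i) = y i := by
  obtain ⟨V, hV⟩ := exists_linearIsometry_of_inner_eq hx h
  obtain ⟨W, hW⟩ := exists_linearIsometry_of_inner_eq hy fun i j => (h i j).symm
  refine ⟨LinearIsometryEquiv.ofSurjective V fun z => ⟨W z, ?_⟩, hV⟩
  refine (denseRange_linearCombination hy).induction_on (p := fun z => V (W z) = z) z
    (isClosed_eq (by fun_prop) (by fun_prop)) fun a => ?_
  induction a using Finsupp.induction_linear with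
  | zero => simp
  | add a b ha hb => simp only [map_add, ha, hb]
  | single i c => simp [hV, hW]

/-- Continuous linear maps agreeing on a total family are equal. -/
theorem ContinuousLinearMap.ext_of_total {x : ι → H}
    (hx : (Submodule.span ℂ (Set.range x)).topologicalClosure = ⊤) {S T : H →L[ℂ] K}
    (h : ∀ i, S (x i) = T (x i)) : S = T :=
  ContinuousLinearMap.ext_on (Submodule.dense_iff_topologicalClosure_eq_top.2 hx) <| by
    rintro _ ⟨i, rfl⟩; exact h i

end Gram

/-! ### Multiplication operators and indicator functions in `L²`. -/

section MulLp

variable {X : Type*} [MeasurableSpace X] {μ : Measure X}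

/-- Multiplication by an essentially bounded function as an operator on `L²`. -/
noncomputable def mulLp (φ : X → ℂ) (hφ : MemLp φ ⊤ μ) : Lp ℂ 2 μ →L[ℂ] Lp ℂ 2 μ :=
  (ContinuousLinearMap.mul ℂ ℂ).holderL μ ⊤ 2 2 hφ.toLp

theorem coeFn_mulLp {φ : X → ℂ} (hφ : MemLp φ ⊤ μ) (f : Lp ℂ 2 μ) :
    mulLp φ hφ f =ᵐ[μ] fun p => φ p * f p := by
  have h := (ContinuousLinearMap.mul ℂ ℂ).coeFn_holder (r := 2) hφ.toLp f
  filter_upwards [h, hφ.coeFn_toLp] with p hp hp'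
  refine (hp : _).trans ?_
  rw [hp']; rfl

theorem memLp_top_indicator_one {S : Set X} (hS : MeasurableSet S) :
    MemLp (S.indicator fun _ => (1 : ℂ)) ⊤ μ :=
  (memLp_top_const 1).indicator hS

theorem topologicalClosure_span_indicatorConstLp [IsFiniteMeasure μ] :
    (Submodule.span ℂ (Set.range fun S : {S : Set X // MeasurableSet S} =>
      indicatorConstLp 2 S.2 (measure_ne_top μ S.1) (1 : ℂ))).topologicalClosure = ⊤ := by
  rw [Submodule.eq_top_iff']
  intro f
  refine Lp.induction (by simp) _ (fun c S hS hμ => ?_) (fun f g _ _ _ hf hg => ?_) ?_ f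
  · have : (Lp.simpleFunc.indicatorConst 2 hS hμ.ne c : Lp ℂ 2 μ) =
        c • indicatorConstLp 2 hS (measure_ne_top μ S) (1 : ℂ) := by
      rw [Lp.simpleFunc.coe_indicatorConst]
      refine Lp.ext ?_
      filter_upwards [indicatorConstLp_coeFn (p := 2) (hs := hS) (hμs := hμ.ne) (c := c),
        Lp.coeFn_smul c (indicatorConstLp 2 hS (measure_ne_top μ S) (1 : ℂ)),
        indicatorConstLp_coeFn (p := 2) (hs := hS) (hμs := measure_ne_top μ S) (c := (1 : ℂ))]
        with p h1 h2 h3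
      rw [h1, h2, Pi.smul_apply, h3]
      by_cases hp : p ∈ S <;> simp [hp]
    rw [this]
    exact Submodule.smul_mem _ _ (Submodule.le_topologicalClosure _
      (Submodule.subset_span ⟨⟨S, hS⟩, rfl⟩))
  · exact add_mem hf hg
  · exact Submodule.isClosed_topologicalClosure _

end MulLp

/-! ### Shift operators through the Cayley transform and the resolvent. -/

section Resolvent

variable {ι H : Type*} [NormedAddCommGroup H] [InnerProductSpace ℂ H]

theorem total_comp_equiv {x : ι → H}
    (hx : (Submodule.span ℂ (Set.range x)).topologicalClosure = ⊤) (e : ι ≃ ι) :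
    (Submodule.span ℂ (Set.range fun w => x (e w))).topologicalClosure = ⊤ := by
  have : (fun w => x (e w)) = x ∘ e := rfl
  rwa [this, e.surjective.range_comp]

/-- The graph of the closed operator with resolvent `S`. -/
def closedGraph (S : H →L[ℂ] H) : Submodule ℂ (H × H) :=
  LinearMap.ker ((ContinuousLinearMap.fst ℂ H H -
    S ∘L (ContinuousLinearMap.snd ℂ H H + I • ContinuousLinearMap.fst ℂ H H)).toLinearMap)

theorem mem_closedGraph {S : H →L[ℂ] H} {a b : H} :
    (a, b) ∈ closedGraph S ↔ a = S (b + I • a) := by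
  simp [closedGraph, LinearMap.mem_ker, sub_eq_zero]

variable [CompleteSpace H]

/-- The operator `S` acts on the total family `x` as the resolvent `(T + i)⁻¹` of the symmetric
operator `T : x w ↦ x (σ w)`; the permutations `κ` and `l` of the index set realize the
multiplications by `T + i` and `T - i`. -/
structure IsShiftResolvent (x : ι → H) (σ : ι → ι) (κ l : ι ≃ ι) (S : H →L[ℂ] H) : Prop where
  total : (Submodule.span ℂ (Set.range x)).topologicalClosure = ⊤
  x_add : ∀ w, x (κ w) = x (σ w) + I • x w
  x_sub : ∀ w, x (l w) = x (σ w) - I • x w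
  comm : ∀ w, κ (l w) = l (κ w)
  apply : ∀ w, S (x (κ w)) = x w
  adjoint_apply : ∀ w, ContinuousLinearMap.adjoint S (x (l w)) = x w

/-- The equal Gram matrices give a unitary `U : x (κ w) ↦ x (l w)`, the Cayley transform `(T - i)(T
+ i)⁻¹`. As `x (κ w) - x (l w) = 2i x w`, the resolvent is `(1 - U) / (2i)`, and its adjoint is
computed from `U⁻¹`. -/
theorem exists_isShiftResolvent {x : ι → H}
    (hx : (Submodule.span ℂ (Set.range x)).topologicalClosure = ⊤) {σ : ι → ι} {κ l : ι ≃ ι}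
    (h_add : ∀ w, x (κ w) = x (σ w) + I • x w) (h_sub : ∀ w, x (l w) = x (σ w) - I • x w)
    (hc : ∀ w, κ (l w) = l (κ w))
    (hg : ∀ w v, inner ℂ (x (l w)) (x (l v)) = inner ℂ (x (κ w)) (x (κ v))) :
    ∃ S : H →L[ℂ] H, IsShiftResolvent x σ κ l S := by
  obtain ⟨U, hU⟩ := exists_linearIsometryEquiv_of_inner_eq (total_comp_equiv hx κ)
    (total_comp_equiv hx l) hg
  let V : H →L[ℂ] H := (U : H ≃L[ℂ] H)
  let V' : H →L[ℂ] H := (U.symm : H ≃L[ℂ] H)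
  let S : H →L[ℂ] H := (2 * I)⁻¹ • (1 - V)
  let S' : H →L[ℂ] H := (-(2 * I)⁻¹) • (1 - V')
  have hdiff : ∀ w, x (κ w) - x (l w) = (2 * I) • x w := by
    intro w; rw [h_add, h_sub, mul_smul, two_smul]; abel
  have hS : ∀ w, S (x (κ w)) = x w := by
    intro w
    have : S (x (κ w)) = (2 * I)⁻¹ • (x (κ w) - x (l w)) := by rw [← hU w]; rfl
    rw [this, hdiff, smul_smul, inv_mul_cancel₀ (by simp), one_smul]
  have hS' : ∀ w, S' (x (l w)) = x w := by
    intro w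
    have h1 : V' (x (l w)) = x (κ w) := by
      rw [← hU w]; exact U.symm_apply_apply _
    have : S' (x (l w)) = (2 * I)⁻¹ • (x (κ w) - x (l w)) := by
      change (-(2 * I)⁻¹) • (x (l w) - V' (x (l w))) = _
      rw [h1, neg_smul, ← smul_neg, neg_sub]
    rw [this, hdiff, smul_smul, inv_mul_cancel₀ (by simp), one_smul]
  have hadj : S' = ContinuousLinearMap.adjoint S := by
    rw [ContinuousLinearMap.eq_adjoint_iff]
    intro a b
    change inner ℂ ((-(2 * I)⁻¹) • (a - U.symm a)) b = inner ℂ a ((2 * I)⁻¹ • (b - U b))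
    rw [inner_smul_left, inner_smul_right, inner_sub_left, inner_sub_right,
      U.symm.inner_map_eq_flip, LinearIsometryEquiv.symm_symm]
    simp [Complex.conj_ofNat]
  exact ⟨S, hx, h_add, h_sub, hc, hS, fun w => by rw [← hadj, hS']⟩

namespace IsShiftResolvent

variable {x : ι → H} {σ : ι → ι} {κ l : ι ≃ ι} {S : H →L[ℂ] H}

/-- This is the resolvent identity for `S = (T + i)⁻¹` and `S* = (T - i)⁻¹`, checked on the total
family `x (l (κ w))`, where both inverses act explicitly. -/
theorem adjoint_sub (h : IsShiftResolvent x σ κ l S) (a : H) :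
    ContinuousLinearMap.adjoint S a - S a = (2 * I) • S (ContinuousLinearMap.adjoint S a) := by
  have : ContinuousLinearMap.adjoint S - S = (2 * I) • (S ∘L ContinuousLinearMap.adjoint S) := by
    refine ContinuousLinearMap.ext_of_total (total_comp_equiv (total_comp_equiv h.total l) κ)
      fun w => ?_
    simp only [sub_apply, smul_apply,
      ContinuousLinearMap.comp_apply]
    rw [h.adjoint_apply, ← h.comm, h.apply (l w), h.apply w, h.x_add, h.x_sub, mul_smul, two_smul]
    abel
  simpa using congrArg (fun T : H →L[ℂ] H => T a) this

theorem adjoint_comm (h : IsShiftResolvent x σ κ l S) (a : H) :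
    ContinuousLinearMap.adjoint S (S a) = S (ContinuousLinearMap.adjoint S a) := by
  have : ContinuousLinearMap.adjoint S ∘L S = S ∘L ContinuousLinearMap.adjoint S := by
    refine ContinuousLinearMap.ext_of_total (total_comp_equiv (total_comp_equiv h.total l) κ)
      fun w => ?_
    simp only [ContinuousLinearMap.comp_apply]
    rw [h.adjoint_apply, ← h.comm, h.apply (l w), h.adjoint_apply, h.apply]
  simpa using congrArg (fun T : H →L[ℂ] H => T a) this

/-- By the resolvent identity and normality the adjoint kills `a` as well, so `a` is orthogonal to
the range of `S`, which contains every `x w`. -/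
theorem injective (h : IsShiftResolvent x σ κ l S) {a : H} (ha : S a = 0) : a = 0 := by
  have h1 := h.adjoint_sub a
  rw [← h.adjoint_comm, ha, map_zero, smul_zero, sub_zero] at h1
  have hd := Submodule.dense_iff_topologicalClosure_eq_top.2 h.total
  refine hd.eq_zero_of_inner_right ℂ fun {v} hv => ?_
  induction hv using Submodule.span_induction with
  | mem v hv =>
    obtain ⟨w, rfl⟩ := hv
    rw [← h.apply w, ← ContinuousLinearMap.adjoint_inner_right, h1, inner_zero_right]
  | zero => simp
  | add a b _ _ ha hb => rw [inner_add_left, ha, hb, add_zero]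
  | smul c a _ ha => rw [inner_smul_left, ha, mul_zero]

/-- Both sides express `T y = z`, through `(T - i)⁻¹` and `(T + i)⁻¹` respectively. The left form is
the one that arises from the adjoint graph. -/
theorem eq_apply_iff (h : IsShiftResolvent x σ κ l S) (y z : H) :
    y = ContinuousLinearMap.adjoint S (z - I • y) ↔ y = S (z + I • y) := by
  constructor <;> intro hy
  · have h1 := h.adjoint_sub (z - I • y)
    rw [← hy] at h1
    have h2 : z + I • y = (z - I • y) + (2 * I) • y := by
      rw [mul_smul, two_smul]; abel
    rw [h2, map_add, map_smul, ← h1]; abel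
  · have h1 := h.adjoint_sub (z + I • y)
    rw [← h.adjoint_comm, ← hy] at h1
    have h2 : z - I • y = (z + I • y) - (2 * I) • y := by
      rw [mul_smul, two_smul]; abel
    rw [h2, map_sub, map_smul, ← h1]; abel

/-- The continuous map `c ↦ (S c, c - i S c)` parametrizes `closedGraph S` and sends the total
family `x (κ w)` to the generators `(x w, x (σ w))`; density therefore passes to the graph. -/
theorem topologicalClosure_span (h : IsShiftResolvent x σ κ l S) :
    (Submodule.span ℂ (Set.range fun w => (x w, x (σ w)))).topologicalClosure =
      closedGraph S := by
  apply le_antisymm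
  · refine Submodule.topologicalClosure_minimal _ ?_ (ContinuousLinearMap.isClosed_ker _)
    rw [Submodule.span_le]
    rintro _ ⟨w, rfl⟩
    rw [SetLike.mem_coe, mem_closedGraph, ← h.x_add, h.apply]
  · rintro ⟨a, b⟩ hab
    rw [mem_closedGraph] at hab
    let Ψ : H →L[ℂ] H × H := S.prod (1 - I • S)
    have hΨ : (a, b) = Ψ (b + I • a) := by
      change (a, b) = (S (b + I • a), (b + I • a) - I • S (b + I • a))
      rw [← hab, add_sub_cancel_right]
    rw [hΨ]
    have hle : (Submodule.span ℂ (Set.range fun w => x (κ w))).topologicalClosure ≤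
        (Submodule.span ℂ (Set.range fun w => (x w, x (σ w)))).topologicalClosure.comap
          Ψ.toLinearMap := by
      refine Submodule.topologicalClosure_minimal _ ?_
        ((Submodule.isClosed_topologicalClosure _).preimage Ψ.continuous)
      rw [Submodule.span_le]
      rintro _ ⟨w, rfl⟩
      have : Ψ (x (κ w)) = (x w, x (σ w)) := by
        change (S (x (κ w)), x (κ w) - I • S (x (κ w))) = _
        rw [h.apply, h.x_add, add_sub_cancel_right]
      change Ψ (x (κ w)) ∈ (Submodule.span ℂ (Set.range fun w => (x w, x (σ w)))).topologicalClosure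
      rw [this]
      exact Submodule.le_topologicalClosure _ (Submodule.subset_span ⟨w, rfl⟩)
    exact hle (by rw [total_comp_equiv h.total κ]; trivial)

theorem snd_eq_zero (h : IsShiftResolvent x σ κ l S) (p : H × H) (hp : p ∈ closedGraph S)
    (hp1 : p.1 = 0) : p.2 = 0 := by
  obtain ⟨a, b⟩ := p
  obtain rfl : a = 0 := hp1
  rw [mem_closedGraph, smul_zero, add_zero] at hp
  exact h.injective hp.symm

/-- Testing the adjoint condition for `(y, z)` on the graph elements `(S c, c - i S c)` reduces it
to `y = S* (z - i y)`, which by `eq_apply_iff` is membership in the graph itself. -/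
theorem isSelfAdjoint_of_graph_eq (h : IsShiftResolvent x σ κ l S) {T : H →ₗ.[ℂ] H}
    (hT : T.graph = closedGraph S) : IsSelfAdjoint T := by
  have hd : Dense (T.domain : Set H) := by
    refine (Submodule.dense_iff_topologicalClosure_eq_top.2 h.total).mono ?_
    rw [SetLike.coe_subset_coe, Submodule.span_le]
    rintro _ ⟨w, rfl⟩
    have : (x w, x (σ w)) ∈ T.graph := by
      rw [hT, mem_closedGraph, ← h.x_add, h.apply]
    exact LinearPMap.mem_domain_of_mem_graph this
  rw [LinearPMap.isSelfAdjoint_def]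
  refine LinearPMap.eq_of_eq_graph ?_
  rw [LinearPMap.adjoint_graph_eq_graph_adjoint hd, hT]
  ext ⟨y, z⟩
  rw [Submodule.mem_adjoint_iff, mem_closedGraph, ← h.eq_apply_iff]
  have key : ∀ c : H, inner ℂ (c - I • S c) y - inner ℂ (S c) z =
      inner ℂ c (y - ContinuousLinearMap.adjoint S (z - I • y)) := by
    intro c
    simp only [inner_sub_left, inner_sub_right, map_sub, map_smul, inner_smul_left,
      inner_smul_right, ContinuousLinearMap.adjoint_inner_right, conj_I]
    ring
  constructor
  · intro hyz
    rw [← sub_eq_zero, ← inner_self_eq_zero (𝕜 := ℂ), ← key]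
    refine hyz _ _ (mem_closedGraph.2 ?_)
    rw [sub_add_cancel]
  · intro hy a b hab
    have hab' := mem_closedGraph.1 hab
    have := key (b + I • a)
    rw [← hab', add_sub_cancel_right] at this
    rw [this, sub_eq_zero.2 hy, inner_zero_right]

theorem exists_shift_operator (h : IsShiftResolvent x σ κ l S) :
    ∃ T : H →ₗ.[ℂ] H, T.graph = Submodule.span ℂ (Set.range fun w => (x w, x (σ w))) ∧
      T.IsClosable ∧ T.closure.graph = closedGraph S ∧ IsSelfAdjoint T.closure := by
  let G := Submodule.span ℂ (Set.range fun w => (x w, x (σ w)))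
  have hG : G ≤ closedGraph S := by
    rw [← h.topologicalClosure_span]; exact Submodule.le_topologicalClosure _
  -- The shift is well defined on the span: `G` lies in `closedGraph S`, which by injectivity of `S`
  -- contains no `(0, b)` with `b ≠ 0`.
  have hTg : G.toLinearPMap.graph = G :=
    Submodule.toLinearPMap_graph_eq _ fun p hp => h.snd_eq_zero p (hG hp)
  have hCg : (closedGraph S).toLinearPMap.graph = closedGraph S :=
    Submodule.toLinearPMap_graph_eq _ h.snd_eq_zero
  have hcl : G.toLinearPMap.IsClosable :=
    ⟨(closedGraph S).toLinearPMap, by rw [hTg, hCg]; exact h.topologicalClosure_span⟩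
  have hgr : G.toLinearPMap.closure.graph = closedGraph S := by
    rw [← hcl.graph_closure_eq_closure_graph, hTg]; exact h.topologicalClosure_span
  exact ⟨G.toLinearPMap, hTg, hcl, hgr, h.isSelfAdjoint_of_graph_eq hgr⟩

end IsShiftResolvent

end Resolvent

/-! ### Measures with density `‖f‖²`. -/

section NormSqMeasure

variable {X : Type*} [MeasurableSpace X] {μ : Measure X}

/-- The measure with density `‖f‖²`. -/
noncomputable def normSqMeasure (μ : Measure X) (f : X → ℂ) : Measure X :=
  μ.withDensity fun p => ((‖f p‖₊ ^ 2 : NNReal) : ENNReal)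

theorem normSqMeasure_congr {f g : X → ℂ} (h : f =ᵐ[μ] g) :
    normSqMeasure μ f = normSqMeasure μ g :=
  withDensity_congr_ae (by filter_upwards [h] with p hp; rw [hp])

theorem integral_normSqMeasure {E : Type*} [NormedAddCommGroup E] [NormedSpace ℝ E] {f : X → ℂ}
    (hf : AEStronglyMeasurable f μ) (φ : X → E) :
    ∫ p, φ p ∂(normSqMeasure μ f) = ∫ p, ‖f p‖ ^ 2 • φ p ∂μ := by
  rw [normSqMeasure, integral_withDensity_eq_integral_smul₀ (hf.aemeasurable.nnnorm.pow_const 2)]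
  rfl

theorem eLpNorm_normSqMeasure {f φ : X → ℂ} (hf : AEStronglyMeasurable f μ) :
    eLpNorm φ 2 (normSqMeasure μ f) = eLpNorm (fun p => φ p * f p) 2 μ := by
  rw [eLpNorm_eq_lintegral_rpow_enorm_toReal two_ne_zero ENNReal.ofNat_ne_top,
    eLpNorm_eq_lintegral_rpow_enorm_toReal two_ne_zero ENNReal.ofNat_ne_top, normSqMeasure,
    lintegral_withDensity_eq_lintegral_mul_non_measurable₀ _
      (hf.aemeasurable.nnnorm.pow_const 2).coe_nnreal_ennreal
      (.of_forall fun _ => ENNReal.coe_lt_top)]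
  congr 1
  refine lintegral_congr fun p => ?_
  simp only [Pi.mul_apply, enorm_mul, ENNReal.toReal_ofNat, ENNReal.rpow_ofNat, mul_pow,
    ENNReal.coe_pow]
  rw [mul_comm]; rfl

theorem memLp_normSqMeasure_iff {f φ : X → ℂ} (hf : AEStronglyMeasurable f μ)
    (hφ : Measurable φ) :
    MemLp φ 2 (normSqMeasure μ f) ↔ MemLp (fun p => φ p * f p) 2 μ := by
  have h : AEStronglyMeasurable (fun p => φ p * f p) μ := hφ.aestronglyMeasurable.mul hf
  simp only [MemLp, eLpNorm_normSqMeasure hf, hφ.aestronglyMeasurable, true_and, h]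

theorem memLp_ofReal_iff {φ : X → ℝ} {p : ENNReal} :
    MemLp (fun a => (φ a : ℂ)) p μ ↔ MemLp φ p μ :=
  ⟨fun h => by simpa using h.re, fun h => h.ofReal⟩

theorem norm_sq_toLp {f : X → ℂ} (hf : MemLp f 2 μ) :
    ‖hf.toLp‖ ^ 2 = ∫ p, ‖f p‖ ^ 2 ∂μ := by
  have h1 : ((‖hf.toLp‖ ^ 2 : ℝ) : ℂ) = ((∫ p, ‖f p‖ ^ 2 ∂μ : ℝ) : ℂ) := by
    have := inner_self_eq_norm_sq_to_K (𝕜 := ℂ) hf.toLp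
    rw [L2.inner_def] at this
    rw [← integral_complex_ofReal]
    push_cast
    refine this.symm.trans (integral_congr_ae ?_)
    filter_upwards [hf.coeFn_toLp] with p hp
    rw [hp, inner_self_eq_norm_sq_to_K]
    simp
  exact_mod_cast h1

end NormSqMeasure

/-! ### Orthogonal series. -/

section HasSum

variable {H : Type*} [NormedAddCommGroup H] [InnerProductSpace ℂ H]

/-- Pairwise orthogonal vectors sum up to `b` if they are projections of `b` and exhaust its
norm. -/
theorem hasSum_of_hasSum_norm_sq {ι : Type*} {a : ι → H} {b : H}
    (h1 : ∀ i, inner ℂ b (a i) = ((‖a i‖ ^ 2 : ℝ) : ℂ))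
    (h2 : Pairwise fun i j => inner ℂ (a i) (a j) = 0)
    (h3 : HasSum (fun i => ‖a i‖ ^ 2) (‖b‖ ^ 2)) : HasSum a b := by
  have key : ∀ s : Finset ι, ‖b - ∑ i ∈ s, a i‖ ^ 2 = ‖b‖ ^ 2 - ∑ i ∈ s, ‖a i‖ ^ 2 := by
    intro s
    have e1 : (inner ℂ b (∑ i ∈ s, a i)).re = ∑ i ∈ s, ‖a i‖ ^ 2 := by
      rw [inner_sum, Finset.sum_congr rfl fun i _ => h1 i, ← Complex.ofReal_sum, Complex.ofReal_re]
    have e2 : ‖∑ i ∈ s, a i‖ ^ 2 = ∑ i ∈ s, ‖a i‖ ^ 2 := by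
      rw [← inner_self_eq_norm_sq (𝕜 := ℂ), sum_inner, map_sum]
      refine Finset.sum_congr rfl fun i hi => ?_
      rw [inner_sum, Finset.sum_eq_single_of_mem i hi fun j _ hj => h2 hj.symm,
        inner_self_eq_norm_sq]
    have e3 := norm_sub_sq (𝕜 := ℂ) b (∑ i ∈ s, a i)
    rw [e3, e2]
    simp only [RCLike.re_to_complex, e1]
    ring
  rw [HasSum, SummationFilter.unconditional_filter, tendsto_iff_norm_sub_tendsto_zero]
  have h4 : Filter.Tendsto (fun s : Finset ι => √(‖b‖ ^ 2 - ∑ i ∈ s, ‖a i‖ ^ 2)) Filter.atTop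
      (nhds 0) := by
    have := (tendsto_const_nhds (x := ‖b‖ ^ 2)).sub h3
    rw [sub_self] at this
    simpa using this.sqrt
  refine h4.congr fun s => ?_
  rw [← key, Real.sqrt_sq (norm_nonneg _), norm_sub_rev]

end HasSum

/-! ### Scalar measures and images of spectral measures. -/

namespace SpectralMeasure

variable {X : Type*} [MeasurableSpace X] {H : Type*} [NormedAddCommGroup H]
  [InnerProductSpace ℂ H] [CompleteSpace H]

theorem inner_proj_proj (E : SpectralMeasure X H) {S T : Set X} (hS : MeasurableSet S)
    (hT : MeasurableSet T) (g h : H) :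
    inner ℂ (E.proj S g) (E.proj T h) = inner ℂ g (E.proj (S ∩ T) h) := by
  have h2 : ContinuousLinearMap.adjoint (E.proj S) = E.proj S :=
    (E.isStarProjection S hS).isSelfAdjoint.star_eq
  rw [E.proj_inter S T hS hT, ← ContinuousLinearMap.adjoint_inner_right, h2]
  rfl

theorem scalarMeasure_apply (E : SpectralMeasure X H) (h : H) {S : Set X} (hS : MeasurableSet S) :
    E.scalarMeasure h S = ENNReal.ofReal (‖E.proj S h‖ ^ 2) := by
  rw [← E.re_inner_eq h hS]
  exact Measure.ofMeasurable_apply S hS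

instance (E : SpectralMeasure X H) (h : H) : IsFiniteMeasure (E.scalarMeasure h) :=
  ⟨by rw [E.scalarMeasure_apply h .univ]; exact ENNReal.ofReal_lt_top⟩

theorem real_scalarMeasure (E : SpectralMeasure X H) (h : H) {S : Set X} (hS : MeasurableSet S) :
    (E.scalarMeasure h).real S = ‖E.proj S h‖ ^ 2 := by
  rw [Measure.real, E.scalarMeasure_apply h hS, ENNReal.toReal_ofReal (by positivity)]

/-- The image of a spectral measure under a measurable map. -/
noncomputable def map {Y : Type*} [MeasurableSpace Y] (E : SpectralMeasure X H) (f : X → Y)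
    (hf : Measurable f) : SpectralMeasure Y H where
  proj S := E.proj (f ⁻¹' S)
  isStarProjection S hS := E.isStarProjection _ (hf hS)
  proj_univ := E.proj_univ
  proj_inter S T hS hT := E.proj_inter _ _ (hf hS) (hf hT)
  hasSum_iUnion S hS hd h := by
    rw [Set.preimage_iUnion]
    exact E.hasSum_iUnion _ (fun j => hf (hS j)) (fun i j hij => (hd hij).preimage f) h

theorem scalarMeasure_map {Y : Type*} [MeasurableSpace Y] (E : SpectralMeasure X H) {f : X → Y}
    (hf : Measurable f) (h : H) :
    (E.map f hf).scalarMeasure h = (E.scalarMeasure h).map f := by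
  ext S hS
  rw [Measure.map_apply hf hS, scalarMeasure_apply _ _ hS, scalarMeasure_apply _ _ (hf hS)]
  rfl

theorem IsIntegral.map {E : SpectralMeasure X H} {f : X → ℝ} {A : H →ₗ.[ℂ] H}
    (h : E.IsIntegral f A) (hf : Measurable f) :
    (E.map f hf).IsIntegral (fun s => s) A := by
  refine ⟨fun a => ?_, fun a => ?_⟩
  · rw [h.1, scalarMeasure_map]
    exact (memLp_map_measure_iff measurable_id.aestronglyMeasurable hf.aemeasurable).symm
  · rw [h.2, scalarMeasure_map, integral_map hf.aemeasurable (f := fun s : ℝ => s)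
      measurable_id.aestronglyMeasurable]

/-- The spectral measures on the line are the two marginals of `E`; their values commute because
both products equal `E` of the same rectangle. -/
theorem _root_.IsJointSpectralMeasure.spectrallyCommute {E : SpectralMeasure (ℝ × ℝ) H}
    {A B : H →ₗ.[ℂ] H} (h : IsJointSpectralMeasure E A B) : SpectrallyCommute A B := by
  refine ⟨_, _, h.1.map measurable_fst, h.2.map measurable_snd, fun S T hS hT => ?_⟩
  have hS' := (measurable_fst : Measurable (Prod.fst : ℝ × ℝ → ℝ)) hS
  have hT' := (measurable_snd : Measurable (Prod.snd : ℝ × ℝ → ℝ)) hT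
  exact (E.proj_inter _ _ hS' hT').symm.trans
    ((congrArg E.proj (Set.inter_comm _ _)).trans (E.proj_inter _ _ hT' hS'))

end SpectralMeasure

/-! ### Multiplication operators on `L²(μ)` transported to `H`. -/

section MultiplicationModel

variable {X : Type*} [MeasurableSpace X] {μ : Measure X}

/-- Multiplication by an indicator function on `L²`. -/
noncomputable def indLp (μ : Measure X) {S : Set X} (hS : MeasurableSet S) :
    Lp ℂ 2 μ →L[ℂ] Lp ℂ 2 μ :=
  mulLp (S.indicator fun _ => 1) (memLp_top_indicator_one hS)

theorem coeFn_indLp {S : Set X} (hS : MeasurableSet S) (f : Lp ℂ 2 μ) :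
    indLp μ hS f =ᵐ[μ] S.indicator f := by
  filter_upwards [coeFn_mulLp (memLp_top_indicator_one hS) f] with p hp
  rw [indLp, hp]
  by_cases h : p ∈ S <;> simp [h]

theorem indLp_indLp {S T : Set X} (hS : MeasurableSet S) (hT : MeasurableSet T)
    (f : Lp ℂ 2 μ) : indLp μ hS (indLp μ hT f) = indLp μ (hS.inter hT) f := by
  refine Lp.ext ?_
  filter_upwards [coeFn_indLp hS (indLp μ hT f), coeFn_indLp hT f, coeFn_indLp (hS.inter hT) f]
    with p h1 h2 h3
  rw [h1, h3]
  by_cases h : p ∈ S <;> by_cases h' : p ∈ T <;> simp [h, h', h2]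

theorem inner_indLp {S : Set X} (hS : MeasurableSet S) (f g : Lp ℂ 2 μ) :
    inner ℂ (indLp μ hS f) g = inner ℂ f (indLp μ hS g) := by
  rw [L2.inner_def, L2.inner_def]
  refine integral_congr_ae ?_
  filter_upwards [coeFn_indLp hS f, coeFn_indLp hS g] with p h1 h2
  rw [h1, h2]
  by_cases h : p ∈ S <;> simp [h]

theorem inner_indLp_eq {S : Set X} (hS : MeasurableSet S) (f : Lp ℂ 2 μ) :
    inner ℂ f (indLp μ hS f) = ((‖indLp μ hS f‖ ^ 2 : ℝ) : ℂ) := by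
  have h := inner_self_eq_norm_sq_to_K (𝕜 := ℂ) (indLp μ hS f)
  rw [inner_indLp, indLp_indLp] at h
  simp only [Set.inter_self] at h
  rw [h]; norm_cast

theorem norm_sq_indLp {S : Set X} (hS : MeasurableSet S) (f : Lp ℂ 2 μ) :
    ‖indLp μ hS f‖ ^ 2 = ∫ p in S, ‖f p‖ ^ 2 ∂μ := by
  conv_lhs => rw [← Lp.toLp_coeFn (indLp μ hS f) (Lp.memLp _), norm_sq_toLp]
  rw [← integral_indicator hS]
  refine integral_congr_ae ?_
  filter_upwards [coeFn_indLp hS f] with p h1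
  rw [h1]
  by_cases h : p ∈ S <;> simp [h]

theorem integrable_norm_sq (f : Lp ℂ 2 μ) : Integrable (fun p => ‖f p‖ ^ 2) μ :=
  (memLp_two_iff_integrable_sq_norm (Lp.memLp f).1).1 (Lp.memLp f)

theorem hasSum_indLp {S : ℕ → Set X} (hS : ∀ j, MeasurableSet (S j))
    (hd : Pairwise (Function.onFun Disjoint S)) (f : Lp ℂ 2 μ) :
    HasSum (fun j => indLp μ (hS j) f) (indLp μ (MeasurableSet.iUnion hS) f) := by
  refine hasSum_of_hasSum_norm_sq (fun j => ?_) (fun i j hij => ?_) ?_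
  · rw [inner_indLp, indLp_indLp, ← inner_indLp_eq]
    congr 2
    simp only [Set.inter_eq_right.2 (Set.subset_iUnion S j)]
  · simp only [inner_indLp, indLp_indLp, (hd hij).inter_eq]
    refine (inner_indLp_eq MeasurableSet.empty f).trans ?_
    rw [norm_sq_indLp]; simp
  · simp only [norm_sq_indLp]
    exact hasSum_integral_iUnion hS hd (integrable_norm_sq f).integrableOn

variable {H : Type*} [NormedAddCommGroup H] [InnerProductSpace ℂ H]

/-- The operator of multiplication by `φ`, transported to `H` by a unitary map. -/
noncomputable def mulOp (W : Lp ℂ 2 μ ≃ₗᵢ[ℂ] H) (φ : X → ℂ) (hφ : MemLp φ ⊤ μ) : H →L[ℂ] H :=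
  (W : Lp ℂ 2 μ ≃L[ℂ] H).toContinuousLinearMap ∘L mulLp φ hφ ∘L
    (W.symm : H ≃L[ℂ] Lp ℂ 2 μ).toContinuousLinearMap

theorem mulOp_apply (W : Lp ℂ 2 μ ≃ₗᵢ[ℂ] H) {φ : X → ℂ} (hφ : MemLp φ ⊤ μ) (h : H) :
    mulOp W φ hφ h = W (mulLp φ hφ (W.symm h)) := rfl

/-- Multiplication by an indicator function, transported to `H` by a unitary map. -/
noncomputable def indOp (W : Lp ℂ 2 μ ≃ₗᵢ[ℂ] H) {S : Set X} (hS : MeasurableSet S) : H →L[ℂ] H :=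
  mulOp W _ (memLp_top_indicator_one hS)

theorem indOp_apply (W : Lp ℂ 2 μ ≃ₗᵢ[ℂ] H) {S : Set X} (hS : MeasurableSet S) (h : H) :
    indOp W hS h = W (indLp μ hS (W.symm h)) := rfl

variable [CompleteSpace H]

open Classical in
/-- The spectral measure of multiplications by indicator functions, transported to `H` by a unitary
map. -/
noncomputable def mulSpectralMeasure (W : Lp ℂ 2 μ ≃ₗᵢ[ℂ] H) : SpectralMeasure X H where
  proj S := if hS : MeasurableSet S then indOp W hS else 0
  isStarProjection S hS := by
    rw [dif_pos hS]
    refine ⟨?_, ?_⟩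
    · ext h
      rw [mul_apply_eq_comp]
      simp only [indOp_apply, W.symm_apply_apply, indLp_indLp, Set.inter_self]
    · rw [ContinuousLinearMap.isSelfAdjoint_iff', Eq.comm, ContinuousLinearMap.eq_adjoint_iff]
      intro a b
      simp only [indOp_apply]
      rw [← W.symm.inner_map_map, W.symm_apply_apply, inner_indLp, ← W.inner_map_map,
        W.apply_symm_apply]
  proj_univ := by
    rw [dif_pos MeasurableSet.univ]
    ext h
    rw [indOp_apply W MeasurableSet.univ]
    have : indLp μ MeasurableSet.univ (W.symm h) = W.symm h := by
      refine Lp.ext ?_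
      filter_upwards [coeFn_indLp MeasurableSet.univ (W.symm h)] with p hp
      rw [hp]; simp
    rw [this, W.apply_symm_apply]; rfl
  proj_inter S T hS hT := by
    rw [dif_pos hS, dif_pos hT, dif_pos (hS.inter hT)]
    ext h
    rw [mul_apply_eq_comp]
    simp only [indOp_apply, W.symm_apply_apply, indLp_indLp]
  hasSum_iUnion S hS hd h := by
    simp only [hS, MeasurableSet.iUnion hS, dif_pos, indOp_apply]
    exact (hasSum_indLp hS hd (W.symm h)).mapL (W : Lp ℂ 2 μ ≃L[ℂ] H).toContinuousLinearMap

theorem mulSpectralMeasure_proj (W : Lp ℂ 2 μ ≃ₗᵢ[ℂ] H) {S : Set X} (hS : MeasurableSet S)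
    (h : H) : (mulSpectralMeasure W).proj S h = W (indLp μ hS (W.symm h)) := by
  simp only [mulSpectralMeasure, dif_pos hS, indOp_apply]

theorem scalarMeasure_mulSpectralMeasure (W : Lp ℂ 2 μ ≃ₗᵢ[ℂ] H) (h : H) :
    (mulSpectralMeasure W).scalarMeasure h = normSqMeasure μ (W.symm h) := by
  ext S hS
  rw [SpectralMeasure.scalarMeasure_apply _ _ hS, mulSpectralMeasure_proj W hS,
    LinearIsometryEquiv.norm_map, norm_sq_indLp, normSqMeasure, withDensity_apply _ hS,
    ofReal_integral_eq_lintegral_ofReal (integrable_norm_sq _).integrableOn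
      (.of_forall fun p => by positivity)]
  refine lintegral_congr fun p => ?_
  rw [ENNReal.ofReal_pow (norm_nonneg _), ofReal_norm, ENNReal.coe_pow]
  rfl

theorem memLp_top_inv_add_I {φ : X → ℝ} (hφ : Measurable φ) :
    MemLp (fun p => ((φ p : ℂ) + I)⁻¹) ⊤ μ :=
  memLp_top_of_bound
    ((measurable_ofReal.comp hφ).add_const I).inv.aestronglyMeasurable 1
    (.of_forall fun p => MomentIndex.norm_inv_ofReal_add_I_le (φ p))

/-- The operator with resolvent `(φ + i)⁻¹` is the integral of `φ` in the multiplication model. -/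
theorem isIntegral_mulSpectralMeasure (W : Lp ℂ 2 μ ≃ₗᵢ[ℂ] H) {φ : X → ℝ} (hφ : Measurable φ)
    {T : H →ₗ.[ℂ] H}
    (hT : T.graph = closedGraph (mulOp W _ (memLp_top_inv_add_I hφ))) :
    (mulSpectralMeasure W).IsIntegral φ T := by
  have hne : ∀ p, (φ p : ℂ) + I ≠ 0 := fun p => MomentIndex.ofReal_add_I_ne_zero _
  -- The relation `a = (φ + i)⁻¹ (b + i a)` almost everywhere is solved for `b = φ a`.
  have hgr : ∀ a b : H, (a, b) ∈ T.graph →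
      W.symm b =ᵐ[μ] fun p => φ p * W.symm a p := by
    intro a b hab
    rw [hT, mem_closedGraph, mulOp_apply, ← W.symm_apply_eq, map_add, map_smul] at hab
    have h1 := coeFn_mulLp (memLp_top_inv_add_I hφ) (W.symm b + I • W.symm a)
    rw [← hab] at h1
    filter_upwards [h1, Lp.coeFn_add (W.symm b) (I • W.symm a), Lp.coeFn_smul I (W.symm a)]
      with p h1 h2 h3
    rw [h2, Pi.add_apply, h3, Pi.smul_apply, smul_eq_mul, eq_inv_mul_iff_mul_eq₀ (hne p)] at h1
    linear_combination -h1
  refine ⟨fun a => ?_, fun a => ?_⟩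
  · rw [scalarMeasure_mulSpectralMeasure, ← memLp_ofReal_iff,
      memLp_normSqMeasure_iff (Lp.memLp _).1 (φ := fun p => (φ p : ℂ)) (measurable_ofReal.comp hφ)]
    constructor
    · intro ha
      exact (memLp_congr_ae (hgr a _ (LinearPMap.mem_graph T ⟨a, ha⟩))).1 (Lp.memLp _)
    · intro ha
      refine LinearPMap.mem_domain_of_mem_graph (y := W ha.toLp) ?_
      rw [hT, mem_closedGraph, mulOp_apply, ← W.symm_apply_eq, map_add, map_smul,
        W.symm_apply_apply]
      refine Lp.ext ?_
      filter_upwards [coeFn_mulLp (memLp_top_inv_add_I hφ) (ha.toLp + I • W.symm a),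
        Lp.coeFn_add ha.toLp (I • W.symm a), Lp.coeFn_smul I (W.symm a), ha.coeFn_toLp]
        with p h1 h2 h3 h4
      rw [h1, h2, Pi.add_apply, h3, h4, Pi.smul_apply, smul_eq_mul,
        eq_inv_mul_iff_mul_eq₀ (hne p)]
      ring
  · rw [scalarMeasure_mulSpectralMeasure, integral_normSqMeasure (Lp.memLp _).1,
      ← integral_complex_ofReal, ← W.symm.inner_map_map, L2.inner_def]
    refine integral_congr_ae ?_
    filter_upwards [hgr a _ (LinearPMap.mem_graph T a)] with p hp
    rw [hp]
    simp only [RCLike.inner_apply, smul_eq_mul]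
    push_cast
    rw [← Complex.mul_conj']
    ring

end MultiplicationModel

/-- A linear map on a dense subspace with vanishing quadratic form vanishes. -/
theorem eq_zero_of_inner_self {H : Type*} [NormedAddCommGroup H] [InnerProductSpace ℂ H]
    {D : Submodule ℂ H} (hD : Dense (D : Set H)) (N : D →ₗ[ℂ] H)
    (h : ∀ a : D, inner ℂ (a : H) (N a) = 0) (b : D) : N b = 0 := by
  refine hD.eq_zero_of_inner_right ℂ fun {v} hv => ?_
  have h0 : inner ℂ v (N ⟨v, hv⟩) = 0 := h ⟨v, hv⟩
  -- Polarization: `v + b` gives the sum of `⟨v, N b⟩` and `⟨b, N v⟩`, and `v + i b` gives their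
  -- difference.
  have h1 := h (⟨v, hv⟩ + b)
  have h2 := h (⟨v, hv⟩ + I • b)
  simp only [map_add, map_smul, Submodule.coe_add, Submodule.coe_smul, inner_add_left,
    inner_add_right, inner_smul_left, inner_smul_right, h, h0, conj_I, zero_add, add_zero,
    mul_zero] at h1 h2
  have h3 : inner ℂ v (N b) - inner ℂ (b : H) (N ⟨v, hv⟩) = 0 := by
    linear_combination (-I) * h2 + (inner ℂ v (N b) - inner ℂ (b : H) (N ⟨v, hv⟩)) * I_mul_I
  linear_combination (1 / 2 : ℂ) * h1 + (1 / 2 : ℂ) * h3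

/-! ### Spectral integrals through cyclic subspaces. -/

namespace SpectralMeasure

variable {X : Type*} [MeasurableSpace X] {H : Type*} [NormedAddCommGroup H]
  [InnerProductSpace ℂ H] [CompleteSpace H] (E : SpectralMeasure X H)

theorem inner_proj_self (h : H) {S : Set X} (hS : MeasurableSet S) :
    inner ℂ h (E.proj S h) = (((E.scalarMeasure h).real S : ℝ) : ℂ) := by
  have h1 := E.inner_proj_proj hS hS h h
  rw [Set.inter_self] at h1
  rw [← h1, inner_self_eq_norm_sq_to_K, E.real_scalarMeasure h hS]
  norm_cast

/-- Indicators in `L²(E h, h)` and the vectors `E(S) h` have the same Gram matrix, namely `(E(S ∩ T)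
h, h)`, and indicators are total. -/
theorem exists_cyclic (h : H) : ∃ V : Lp ℂ 2 (E.scalarMeasure h) →ₗᵢ[ℂ] H,
    ∀ S : {S : Set X // MeasurableSet S},
      V (indicatorConstLp 2 S.2 (measure_ne_top _ S.1) (1 : ℂ)) = E.proj S h := by
  refine exists_linearIsometry_of_inner_eq topologicalClosure_span_indicatorConstLp fun S T => ?_
  rw [E.inner_proj_proj S.2 T.2, E.inner_proj_self h (S.2.inter T.2), L2.inner_def,
    ← integral_indicator_one (S.2.inter T.2), ← integral_complex_ofReal]
  refine integral_congr_ae ?_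
  filter_upwards [indicatorConstLp_coeFn (p := 2) (hs := S.2)
      (hμs := measure_ne_top (E.scalarMeasure h) S.1) (c := (1 : ℂ)),
    indicatorConstLp_coeFn (p := 2) (hs := T.2)
      (hμs := measure_ne_top (E.scalarMeasure h) T.1) (c := (1 : ℂ))] with p h1 h2
  rw [h1, h2]
  by_cases hS : p ∈ S.1 <;> by_cases hT : p ∈ T.1 <;> simp [hS, hT]

/-- The isometry `f ↦ (∫ f dE) h` of `L²(E h, h)` onto the cyclic subspace generated by `h`. -/
noncomputable def cyclic (h : H) : Lp ℂ 2 (E.scalarMeasure h) →ₗᵢ[ℂ] H := (E.exists_cyclic h).choose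

theorem cyclic_indicator (h : H) {S : Set X} (hS : MeasurableSet S) :
    E.cyclic h (indicatorConstLp 2 hS (measure_ne_top _ S) (1 : ℂ)) = E.proj S h :=
  (E.exists_cyclic h).choose_spec ⟨S, hS⟩

theorem proj_cyclic (h : H) {S : Set X} (hS : MeasurableSet S)
    (g : Lp ℂ 2 (E.scalarMeasure h)) :
    E.proj S (E.cyclic h g) = E.cyclic h (indLp _ hS g) := by
  have : E.proj S ∘L (E.cyclic h).toContinuousLinearMap =
      (E.cyclic h).toContinuousLinearMap ∘L indLp _ hS := by
    refine ContinuousLinearMap.ext_of_total topologicalClosure_span_indicatorConstLp fun T => ?_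
    change E.proj S (E.cyclic h _) = E.cyclic h (indLp _ hS _)
    have hi : indLp (E.scalarMeasure h) hS
        (indicatorConstLp 2 T.2 (measure_ne_top _ T.1) (1 : ℂ)) =
        indicatorConstLp 2 (hS.inter T.2) (measure_ne_top _ _) (1 : ℂ) := by
      refine Lp.ext ?_
      filter_upwards [coeFn_indLp hS
          (indicatorConstLp 2 T.2 (measure_ne_top (E.scalarMeasure h) T.1) (1 : ℂ)),
        indicatorConstLp_coeFn (p := 2) (hs := T.2)
          (hμs := measure_ne_top (E.scalarMeasure h) T.1) (c := (1 : ℂ)),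
        indicatorConstLp_coeFn (p := 2) (hs := hS.inter T.2)
          (hμs := measure_ne_top (E.scalarMeasure h) _) (c := (1 : ℂ))] with p h1 h2 h3
      rw [h1, h3]
      by_cases hS : p ∈ S <;> by_cases hT : p ∈ T.1 <;> simp [hS, hT, h2]
    rw [E.cyclic_indicator h T.2, hi, E.cyclic_indicator h, E.proj_inter S T.1 hS T.2]
    rfl
  exact congrArg (fun T : Lp ℂ 2 (E.scalarMeasure h) →L[ℂ] H => T g) this

theorem scalarMeasure_cyclic (h : H) (g : Lp ℂ 2 (E.scalarMeasure h)) :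
    E.scalarMeasure (E.cyclic h g) = normSqMeasure (E.scalarMeasure h) g := by
  ext S hS
  rw [E.scalarMeasure_apply _ hS, E.proj_cyclic h hS, LinearIsometry.norm_map, norm_sq_indLp,
    normSqMeasure, withDensity_apply _ hS,
    ofReal_integral_eq_lintegral_ofReal (integrable_norm_sq _).integrableOn
      (.of_forall fun p => by positivity)]
  refine lintegral_congr fun p => ?_
  rw [ENNReal.ofReal_pow (norm_nonneg _), ofReal_norm, ENNReal.coe_pow]
  rfl

theorem cyclic_one (h : H) : E.cyclic h (memLp_const (1 : ℂ)).toLp = h := by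
  have h1 := E.cyclic_indicator h MeasurableSet.univ
  rw [E.proj_univ] at h1
  refine Eq.trans ?_ h1
  congr 1
  refine Lp.ext ?_
  filter_upwards [indicatorConstLp_coeFn (p := 2) (hs := MeasurableSet.univ)
      (hμs := measure_ne_top (E.scalarMeasure h) _) (c := (1 : ℂ)),
    (memLp_const (μ := E.scalarMeasure h) (p := 2) (1 : ℂ)).coeFn_toLp] with p h1 h2
  rw [h1, h2]; simp

theorem inner_cyclic (h : H) {f : X → ℂ} (hf : MemLp f 2 (E.scalarMeasure h)) :
    inner ℂ h (E.cyclic h hf.toLp) = ∫ p, f p ∂(E.scalarMeasure h) := by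
  have h1 : inner ℂ (E.cyclic h (memLp_const (1 : ℂ)).toLp) (E.cyclic h hf.toLp) =
      ∫ p, f p ∂(E.scalarMeasure h) := by
    rw [LinearIsometry.inner_map_map, L2.inner_def]
    refine integral_congr_ae ?_
    filter_upwards [hf.coeFn_toLp,
      (memLp_const (μ := E.scalarMeasure h) (p := 2) (1 : ℂ)).coeFn_toLp] with p h1 h2
    rw [h1, h2]; simp
  rwa [E.cyclic_one] at h1

/-- The integral of a simple function is a bounded operator, multiplicative on cyclic
subspaces. -/
theorem exists_simpleOp (s : SimpleFunc X ℂ) : ∃ T : H →L[ℂ] H,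
    (∀ h, E.cyclic h (s.memLp_of_isFiniteMeasure 2 _).toLp = T h) ∧
    ∀ h g, T (E.cyclic h g) = E.cyclic h (mulLp s (s.memLp_of_isFiniteMeasure ⊤ _) g) := by
  induction s using SimpleFunc.induction with
  | @const c S hS =>
    refine ⟨c • E.proj S, fun h => ?_, fun h g => ?_⟩
    · rw [smul_apply, ← E.cyclic_indicator h hS, ← map_smul]
      congr 1
      refine Lp.ext ?_
      filter_upwards [(SimpleFunc.memLp_of_isFiniteMeasure (SimpleFunc.piecewise S hS
          (SimpleFunc.const X c) (SimpleFunc.const X 0)) 2 (E.scalarMeasure h)).coeFn_toLp,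
        Lp.coeFn_smul c (indicatorConstLp 2 hS (measure_ne_top (E.scalarMeasure h) S) (1 : ℂ)),
        indicatorConstLp_coeFn (p := 2) (hs := hS)
          (hμs := measure_ne_top (E.scalarMeasure h) S) (c := (1 : ℂ))] with p h1 h2 h3
      rw [h1, h2, Pi.smul_apply, h3]
      by_cases hp : p ∈ S <;> simp [hp]
    · rw [smul_apply, E.proj_cyclic h hS, ← map_smul]
      congr 1
      refine Lp.ext ?_
      filter_upwards [coeFn_mulLp (SimpleFunc.memLp_of_isFiniteMeasure (SimpleFunc.piecewise S hS
          (SimpleFunc.const X c) (SimpleFunc.const X 0)) ⊤ (E.scalarMeasure h)) g,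
        Lp.coeFn_smul c (indLp (E.scalarMeasure h) hS g), coeFn_indLp hS g] with p h1 h2 h3
      rw [h1, h2, Pi.smul_apply, h3]
      by_cases hp : p ∈ S <;> simp [hp]
  | @add f g hd hf hg =>
    obtain ⟨T, hT, hT'⟩ := hf
    obtain ⟨T₁, hT₁, hT₁'⟩ := hg
    refine ⟨T + T₁, fun h => ?_, fun h a => ?_⟩
    · rw [add_apply, ← hT, ← hT₁, ← map_add, ← MemLp.toLp_add]
      rfl
    · rw [add_apply, hT', hT₁', ← map_add]
      congr 1
      refine Lp.ext ?_
      filter_upwards [coeFn_mulLp (f.memLp_of_isFiniteMeasure ⊤ _) a,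
        coeFn_mulLp (g.memLp_of_isFiniteMeasure ⊤ _) a,
        coeFn_mulLp ((f + g).memLp_of_isFiniteMeasure ⊤ _) a,
        Lp.coeFn_add (mulLp f (f.memLp_of_isFiniteMeasure ⊤ _) a)
          (mulLp g (g.memLp_of_isFiniteMeasure ⊤ _) a)] with p h1 h2 h3 h4
      rw [h4, h3, Pi.add_apply, h1, h2, SimpleFunc.coe_add, Pi.add_apply, add_mul]

/-- The vector `k` is `(∫ f dE) h`. -/
def Represents (h : H) (f : X → ℂ) (k : H) : Prop :=
  ∃ hf : MemLp f 2 (E.scalarMeasure h), E.cyclic h hf.toLp = k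

variable {E}

/-- Spectral integrals are approximated by operators that do not depend on the vector. -/
theorem exists_approximation {f : X → ℂ} (hf : Measurable f) :
    ∃ T : ℕ → H →L[ℂ] H, ∀ h k, E.Represents h f k →
      Filter.Tendsto (fun n => T n h) Filter.atTop (nhds k) := by
  choose T hT _ using fun n =>
    E.exists_simpleOp (SimpleFunc.approxOn f hf (Set.range f ∪ {0}) 0 (by simp) n)
  refine ⟨T, ?_⟩
  rintro h _ ⟨hm, rfl⟩
  simp only [← hT]
  exact ((E.cyclic h).continuous.tendsto _).comp
    (SimpleFunc.tendsto_approxOn_range_Lp ENNReal.ofNat_ne_top hf hm)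

theorem Represents.memLp {h k : H} {f : X → ℂ} (hk : E.Represents h f k) :
    MemLp f 2 (E.scalarMeasure h) := hk.1

theorem Represents.inner_eq {h k : H} {f : X → ℂ} (hk : E.Represents h f k) :
    inner ℂ h k = ∫ p, f p ∂(E.scalarMeasure h) := by
  obtain ⟨hf, rfl⟩ := hk
  exact E.inner_cyclic h hf

theorem represents_one (h : H) : E.Represents h (fun _ => 1) h :=
  ⟨memLp_const 1, E.cyclic_one h⟩

theorem Represents.unique {h k k' : H} {f : X → ℂ} (hk : E.Represents h f k)
    (hk' : E.Represents h f k') : k = k' := by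
  obtain ⟨_, rfl⟩ := hk
  obtain ⟨_, rfl⟩ := hk'
  rfl

theorem Represents.congr {h k : H} {f g : X → ℂ} (hk : E.Represents h f k) (hfg : ∀ p, f p = g p) :
    E.Represents h g k := by
  rwa [← funext hfg]

theorem Represents.add {h k k' : H} {f g : X → ℂ} (hk : E.Represents h f k)
    (hk' : E.Represents h g k') : E.Represents h (fun p => f p + g p) (k + k') := by
  obtain ⟨hf, rfl⟩ := hk
  obtain ⟨hg, rfl⟩ := hk'
  exact ⟨hf.add hg, by rw [← map_add, ← MemLp.toLp_add]; rfl⟩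

theorem Represents.smul {h k : H} {f : X → ℂ} (hk : E.Represents h f k) (c : ℂ) :
    E.Represents h (fun p => c * f p) (c • k) := by
  obtain ⟨hf, rfl⟩ := hk
  exact ⟨hf.const_mul c, by rw [← map_smul, ← MemLp.toLp_const_smul]; rfl⟩

theorem Represents.scalarMeasure_eq {h k : H} {f : X → ℂ} (hk : E.Represents h f k) :
    E.scalarMeasure k = normSqMeasure (E.scalarMeasure h) f := by
  obtain ⟨hf, rfl⟩ := hk
  rw [E.scalarMeasure_cyclic, normSqMeasure_congr hf.coeFn_toLp]

/-- Multiplicativity of the spectral integral. -/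
theorem Represents.comp {h k k' : H} {f g : X → ℂ} (hk : E.Represents h g k)
    (hk' : E.Represents k f k') (hf : Measurable f) :
    E.Represents h (fun p => f p * g p) k' := by
  have hν := hk.scalarMeasure_eq
  obtain ⟨hg, rfl⟩ := hk
  obtain ⟨hfk, rfl⟩ := hk'
  set k := E.cyclic h hg.toLp with hkdef
  have hfg : MemLp (fun p => f p * g p) 2 (E.scalarMeasure h) := by
    rw [← memLp_normSqMeasure_iff hg.1 hf, ← hν]; exact hfk
  refine ⟨hfg, ?_⟩
  -- With `T n = ∫ (s n) dE`, the sequence `T n k` has two limits to compare: in the cyclic space of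
  -- `k` it tends to `(∫ f dE) k`, and in that of `h` it is the integral of `s n * g`, tending to
  -- that of `f * g`.
  let s : ℕ → SimpleFunc X ℂ := SimpleFunc.approxOn f hf (Set.range f ∪ {0}) 0 (by simp)
  choose T hT hT' using fun n => E.exists_simpleOp (s n)
  have h1 : Filter.Tendsto (fun n => T n k) Filter.atTop (nhds (E.cyclic k hfk.toLp)) := by
    simp only [← hT]
    exact ((E.cyclic k).continuous.tendsto _).comp
      (SimpleFunc.tendsto_approxOn_range_Lp ENNReal.ofNat_ne_top hf hfk)
  refine tendsto_nhds_unique ?_ h1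
  simp only [hkdef, hT']
  refine ((E.cyclic h).continuous.tendsto _).comp ?_
  rw [Lp.tendsto_Lp_iff_tendsto_eLpNorm']
  have h2 := SimpleFunc.tendsto_approxOn_range_Lp_eLpNorm (p := 2) ENNReal.ofNat_ne_top hf hfk.2
  rw [hν] at h2
  refine h2.congr fun n => ?_
  rw [eLpNorm_normSqMeasure hg.1]
  refine eLpNorm_congr_ae ?_
  filter_upwards [coeFn_mulLp ((s n).memLp_of_isFiniteMeasure ⊤ (E.scalarMeasure h)) hg.toLp,
    hg.coeFn_toLp, hfg.coeFn_toLp] with p h1 h2 h3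
  rw [Pi.sub_apply, Pi.sub_apply, h1, h2, h3, ← sub_mul]

/-- The `L²` spaces of different vectors are not directly comparable, so additivity in the vector is
inherited from bounded operators approximating the integral at every vector simultaneously. -/
theorem Represents.eq_add {h₁ h₂ k₁ k₂ k : H} {f : X → ℂ} (hf : Measurable f)
    (h1 : E.Represents h₁ f k₁) (h2 : E.Represents h₂ f k₂) (h : E.Represents (h₁ + h₂) f k) :
    k = k₁ + k₂ := by
  obtain ⟨T, hT⟩ := E.exists_approximation hf
  refine tendsto_nhds_unique (hT _ _ h) ?_
  simp only [map_add]
  exact (hT _ _ h1).add (hT _ _ h2)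

theorem Represents.eq_smul {h₁ k₁ k : H} {f : X → ℂ} (c : ℂ) (hf : Measurable f)
    (h1 : E.Represents h₁ f k₁) (h : E.Represents (c • h₁) f k) : k = c • k₁ := by
  obtain ⟨T, hT⟩ := E.exists_approximation hf
  refine tendsto_nhds_unique (hT _ _ h) ?_
  simp only [map_smul]
  exact (hT _ _ h1).const_smul c

/-- If `A = ∫ φ dE` is densely defined then `A a = (∫ φ dE) a` for all `a` in its domain. -/
theorem IsIntegral.represents {φ : X → ℝ} {A : H →ₗ.[ℂ] H} (hA : E.IsIntegral φ A)
    (hφ : Measurable φ) (hD : Dense (A.domain : Set H)) (a : A.domain) :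
    E.Represents (a : H) (fun p => (φ p : ℂ)) (A a) := by
  have hm : ∀ a : A.domain, MemLp (fun p => (φ p : ℂ)) 2 (E.scalarMeasure (a : H)) :=
    fun a => memLp_ofReal_iff.2 ((hA.1 a).1 a.2)
  have hR : ∀ a : A.domain, E.Represents (a : H) (fun p => (φ p : ℂ)) (E.cyclic a (hm a).toLp) :=
    fun a => ⟨hm a, rfl⟩
  have hφ' : Measurable fun p => (φ p : ℂ) := measurable_ofReal.comp hφ
  -- `IsIntegral` controls only the quadratic form of `A`; the difference from the spectral integral
  -- has zero form on a dense domain, hence vanishes.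
  let N : A.domain →ₗ[ℂ] H := A.toFun - IsLinearMap.mk' (fun a => E.cyclic _ (hm a).toLp)
    { map_add := fun a b => Represents.eq_add hφ' (hR a) (hR b) (hR (a + b))
      map_smul := fun c a => Represents.eq_smul c hφ' (hR a) (hR (c • a)) }
  have hN := eq_zero_of_inner_self hD N (fun a => by
    change inner ℂ (a : H) (A a - E.cyclic _ (hm a).toLp) = 0
    rw [inner_sub_right, hA.2, (hR a).inner_eq, integral_complex_ofReal, sub_self]) a
  have : A a = E.cyclic _ (hm a).toLp := sub_eq_zero.1 hN
  rw [this]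
  exact hR a

end SpectralMeasure

/-! ### Shifts as spectral integrals. -/

namespace IsShiftResolvent

variable {ι H X : Type*} [NormedAddCommGroup H] [InnerProductSpace ℂ H] [CompleteSpace H]
  [MeasurableSpace X] {x : ι → H} {σ : ι → ι} {κ l : ι ≃ ι} {S : H →L[ℂ] H} {T : H →ₗ.[ℂ] H}
  {E : SpectralMeasure X H} {φ : X → ℝ}

theorem represents_shift (h : IsShiftResolvent x σ κ l S) (hT : T.graph = closedGraph S)
    (hE : E.IsIntegral φ T) (hφ : Measurable φ) (w : ι) :
    E.Represents (x w) (fun p => (φ p : ℂ)) (x (σ w)) := by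
  have hd : Dense (T.domain : Set H) := (h.isSelfAdjoint_of_graph_eq hT).dense_domain
  have hw : (x w, x (σ w)) ∈ T.graph := by
    rw [hT, mem_closedGraph, ← h.x_add, h.apply]
  obtain ⟨a, ha, ha'⟩ := (LinearPMap.mem_graph_iff T).1 hw
  have := hE.represents hφ hd a
  rwa [ha, ha'] at this

theorem represents_add (h : IsShiftResolvent x σ κ l S) (hT : T.graph = closedGraph S)
    (hE : E.IsIntegral φ T) (hφ : Measurable φ) (w : ι) :
    E.Represents (x w) (fun p => (φ p : ℂ) + I) (x (κ w)) := by
  rw [h.x_add]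
  exact ((h.represents_shift hT hE hφ w).add
    ((SpectralMeasure.represents_one (x w)).smul I)).congr fun p => by rw [mul_one]

theorem represents_sub (h : IsShiftResolvent x σ κ l S) (hT : T.graph = closedGraph S)
    (hE : E.IsIntegral φ T) (hφ : Measurable φ) (w : ι) :
    E.Represents (x w) (fun p => (φ p : ℂ) - I) (x (l w)) := by
  have := ((h.represents_shift hT hE hφ w).add
    ((SpectralMeasure.represents_one (x w)).smul (-I))).congr (g := fun p => (φ p : ℂ) - I)
    fun p => by ring
  rwa [neg_smul, ← sub_eq_add_neg, ← h.x_sub] at this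

end IsShiftResolvent

/-- The inverse `f⁻¹` is bounded, hence integrable against any scalar measure, and multiplicativity
turns `f⁻¹ * f = 1` into the claim. This is what reaches the negative exponents. -/
theorem SpectralMeasure.Represents.symm_of_bounded_inv {X H : Type*} [NormedAddCommGroup H]
    [InnerProductSpace ℂ H] [CompleteSpace H] [MeasurableSpace X] {E : SpectralMeasure X H}
    {h k : H} {f : X → ℂ} (hk : E.Represents h f k) (hf : Measurable f)
    (h1 : ∀ p, 1 ≤ ‖f p‖) : E.Represents k (fun p => (f p)⁻¹) h := by
  have hm : MemLp (fun p => (f p)⁻¹) 2 (E.scalarMeasure k) :=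
    MemLp.of_bound hf.inv.aestronglyMeasurable 1 (.of_forall fun p => by
      rw [norm_inv]; exact inv_le_one_of_one_le₀ (h1 p))
  have hR : E.Represents k (fun p => (f p)⁻¹) (E.cyclic k hm.toLp) := ⟨hm, rfl⟩
  have h2 := (hk.comp hR hf.inv).congr (g := fun _ => 1) fun p =>
    inv_mul_cancel₀ (norm_pos_iff.1 (zero_lt_one.trans_le (h1 p)))
  rwa [h2.unique (SpectralMeasure.represents_one h)] at hR

/-! ### Permutations of the indices and induction along them. -/

namespace MomentIndex

/-- Raising `k` by one, as a permutation of the indices. -/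
def kEquiv : MomentIndex ≃ MomentIndex where
  toFun := incK
  invFun w := { w with k := w.k - 1 }
  left_inv w := by ext <;> simp [incK]
  right_inv w := by ext <;> simp [incK]

/-- Raising `l` by one, as a permutation of the indices. -/
def lEquiv : MomentIndex ≃ MomentIndex where
  toFun := incL
  invFun w := { w with l := w.l - 1 }
  left_inv w := by ext <;> simp [incL]
  right_inv w := by ext <;> simp [incL]

/-- Raising `r` by one, as a permutation of the indices. -/
def rEquiv : MomentIndex ≃ MomentIndex where
  toFun := incR
  invFun w := { w with r := w.r - 1 }
  left_inv w := by ext <;> simp [incR]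
  right_inv w := by ext <;> simp [incR]

/-- Raising `t` by one, as a permutation of the indices. -/
def tEquiv : MomentIndex ≃ MomentIndex where
  toFun := incT
  invFun w := { w with t := w.t - 1 }
  left_inv w := by ext <;> simp [incT]
  right_inv w := by ext <;> simp [incT]

theorem one_le_norm_ofReal_sub_I (s : ℝ) : 1 ≤ ‖(s : ℂ) - I‖ := by
  simpa using Complex.abs_im_le_norm ((s : ℂ) - I)

/-- Induction over the indices by unit steps in all directions. -/
theorem induction_steps {P : MomentIndex → Prop} (h0 : P zero) (hM : ∀ w, P w → P w.incM)
    (hN : ∀ w, P w → P w.incN) (hK : ∀ w, P w.incK ↔ P w) (hL : ∀ w, P w.incL ↔ P w)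
    (hR : ∀ w, P w.incR ↔ P w) (hT : ∀ w, P w.incT ↔ P w) (w : MomentIndex) : P w := by
  have hint : ∀ Q : ℤ → Prop, Q 0 → (∀ z, Q (z + 1) ↔ Q z) → ∀ z, Q z := by
    intro Q q0 q z
    induction z using Int.induction_on with
    | zero => exact q0
    | succ i hi => exact (q _).2 hi
    | pred i hi => rw [← q, sub_add_cancel]; exact hi
  obtain ⟨m, k, l, n, r, t⟩ := w
  have e1 : P ⟨0, k, 0, 0, 0, 0⟩ := hint (fun z => P ⟨0, z, 0, 0, 0, 0⟩) h0
    (fun z => hK ⟨0, z, 0, 0, 0, 0⟩) k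
  have e2 : P ⟨0, k, l, 0, 0, 0⟩ := hint (fun z => P ⟨0, k, z, 0, 0, 0⟩) e1
    (fun z => hL ⟨0, k, z, 0, 0, 0⟩) l
  have e3 : P ⟨0, k, l, 0, r, 0⟩ := hint (fun z => P ⟨0, k, l, 0, z, 0⟩) e2
    (fun z => hR ⟨0, k, l, 0, z, 0⟩) r
  have e4 : P ⟨0, k, l, 0, r, t⟩ := hint (fun z => P ⟨0, k, l, 0, r, z⟩) e3
    (fun z => hT ⟨0, k, l, 0, r, z⟩) t
  have e5 : P ⟨m, k, l, 0, r, t⟩ := by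
    induction m with
    | zero => exact e4
    | succ m hm => exact hM _ hm
  induction n with
  | zero => exact e5
  | succ n hn => exact hN _ hn

end MomentIndex

/-! ### Shift operators on a representing family. -/

namespace IsRepresentingFamily

variable {u : MomentIndex → ℂ} {H : Type*} [NormedAddCommGroup H] [InnerProductSpace ℂ H]
  {x : MomentIndex → H}

theorem ext_inner (hx : IsRepresentingFamily u x) {a b : H}
    (h : ∀ v, inner ℂ (x v) a = inner ℂ (x v) b) : a = b := by
  have hd := Submodule.dense_iff_topologicalClosure_eq_top.2 hx.2
  refine hd.eq_of_inner_right ℂ fun {v} hv => ?_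
  induction hv using Submodule.span_induction with
  | mem v hv => obtain ⟨w, rfl⟩ := hv; exact h w
  | zero => simp
  | add a b _ _ ha hb => rw [inner_add_left, inner_add_left, ha, hb]
  | smul c a _ ha => rw [inner_smul_left, inner_smul_left, ha]

variable [CompleteSpace H]

/-- Tested against each `x v`, the recurrences become the vector relations for `A₀ ± i`. The Gram
matrices agree because pairing swaps `k` and `l`: raising either one in both arguments gives the
same index. This reflects `|s + i| = |s - i|` for real `s`. -/
theorem exists_resolvent_fst (hx : IsRepresentingFamily u x) (hu : MomentRecurrences u) :
    ∃ S : H →L[ℂ] H, IsShiftResolvent x incM kEquiv lEquiv S := by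
  refine exists_isShiftResolvent hx.2 (fun w => hx.ext_inner fun v => ?_)
    (fun w => hx.ext_inner fun v => ?_) (fun w => rfl) (fun w v => ?_)
  · rw [inner_add_right, inner_smul_right, hx.1, hx.1, hx.1]
    exact (hu.rec_k w v).symm
  · rw [inner_sub_right, inner_smul_right, hx.1, hx.1, hx.1]
    exact (hu.rec_l w v).symm
  · rw [hx.1, hx.1]
    congr 1
    ext <;> simp [kEquiv, lEquiv, incK, incL, pair] <;> ring

theorem exists_resolvent_snd (hx : IsRepresentingFamily u x) (hu : MomentRecurrences u) :
    ∃ S : H →L[ℂ] H, IsShiftResolvent x incN rEquiv tEquiv S := by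
  refine exists_isShiftResolvent hx.2 (fun w => hx.ext_inner fun v => ?_)
    (fun w => hx.ext_inner fun v => ?_) (fun w => rfl) (fun w v => ?_)
  · rw [inner_add_right, inner_smul_right, hx.1, hx.1, hx.1]
    exact (hu.rec_r w v).symm
  · rw [inner_sub_right, inner_smul_right, hx.1, hx.1, hx.1]
    exact (hu.rec_t w v).symm
  · rw [hx.1, hx.1]
    congr 1
    ext <;> simp [rEquiv, tEquiv, incR, incT, pair] <;> ring

/-- For every joint spectral measure of the two shift operators, `x w` is the spectral integral of
`fn w` applied to `x 0`. -/
theorem represents_fn {S₁ S₂ : H →L[ℂ] H} (h₁ : IsShiftResolvent x incM kEquiv lEquiv S₁)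
    (h₂ : IsShiftResolvent x incN rEquiv tEquiv S₂) {A B : H →ₗ.[ℂ] H}
    (hA : A.graph = closedGraph S₁) (hB : B.graph = closedGraph S₂)
    {E : SpectralMeasure (ℝ × ℝ) H} (hE : IsJointSpectralMeasure E A B) (w : MomentIndex) :
    E.Represents (x zero) w.fn (x w) := by
  have m1 : Measurable fun p : ℝ × ℝ => (p.1 : ℂ) := measurable_ofReal.comp measurable_fst
  have m2 : Measurable fun p : ℝ × ℝ => (p.2 : ℂ) := measurable_ofReal.comp measurable_snd
  -- Multiplication by `xⱼ ± i` can be undone, so these steps run in both directions along `ℤ`.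
  have key : ∀ {g : ℝ × ℝ → ℂ} {w v : MomentIndex}, Measurable g → (∀ p, 1 ≤ ‖g p‖) →
      E.Represents (x w) g (x v) → (∀ p, v.fn p = g p * w.fn p) →
      (E.Represents (x zero) v.fn (x v) ↔ E.Represents (x zero) w.fn (x w)) := by
    intro g w v hg h1 hR hfn
    constructor
    · intro h
      refine (h.comp (hR.symm_of_bounded_inv hg h1) hg.inv).congr fun p => ?_
      rw [hfn, inv_mul_cancel_left₀ (norm_pos_iff.1 (zero_lt_one.trans_le (h1 p)))]
    · intro h
      exact (h.comp hR hg).congr fun p => (hfn p).symm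
  refine induction_steps (P := fun w => E.Represents (x zero) w.fn (x w)) ?_ (fun w hw => ?_)
    (fun w hw => ?_) (fun w => ?_) (fun w => ?_) (fun w => ?_) (fun w => ?_) w
  · exact (SpectralMeasure.represents_one _).congr fun p => (fn_zero p).symm
  · exact (hw.comp (h₁.represents_shift hA hE.1 measurable_fst w) m1).congr
      fun p => (fn_incM w p).symm
  · exact (hw.comp (h₂.represents_shift hB hE.2 measurable_snd w) m2).congr
      fun p => (fn_incN w p).symm
  · exact key (m1.add_const I) (fun p => one_le_norm_ofReal_add_I p.1)
      (h₁.represents_add hA hE.1 measurable_fst w) (fn_incK w)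
  · exact key (m1.sub_const I) (fun p => one_le_norm_ofReal_sub_I p.1)
      (h₁.represents_sub hA hE.1 measurable_fst w) (fn_incL w)
  · exact key (m2.add_const I) (fun p => one_le_norm_ofReal_add_I p.2)
      (h₂.represents_add hB hE.2 measurable_snd w) (fn_incR w)
  · exact key (m2.sub_const I) (fun p => one_le_norm_ofReal_sub_I p.2)
      (h₂.represents_sub hB hE.2 measurable_snd w) (fn_incT w)

theorem isMomentSolution_scalarMeasure (hx : IsRepresentingFamily u x) {S₁ S₂ : H →L[ℂ] H}
    (h₁ : IsShiftResolvent x incM kEquiv lEquiv S₁)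
    (h₂ : IsShiftResolvent x incN rEquiv tEquiv S₂) {A B : H →ₗ.[ℂ] H}
    (hA : A.graph = closedGraph S₁) (hB : B.graph = closedGraph S₂)
    {E : SpectralMeasure (ℝ × ℝ) H} (hE : IsJointSpectralMeasure E A B) :
    IsMomentSolution u (E.scalarMeasure (x zero)) := by
  intro w
  have hR := represents_fn h₁ h₂ hA hB hE w
  refine ⟨hR.memLp.integrable one_le_two, ?_⟩
  rw [← hR.inner_eq, hx.1]
  congr 1
  ext <;> simp [pair, zero]

/-- The multiplication model yields a joint spectral measure of the shift operators. -/
theorem exists_isJointSpectralMeasure (hx : IsRepresentingFamily u x) {μ : Measure (ℝ × ℝ)}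
    (hμ : IsMomentSolution u μ) {S₁ S₂ : H →L[ℂ] H}
    (h₁ : IsShiftResolvent x incM kEquiv lEquiv S₁)
    (h₂ : IsShiftResolvent x incN rEquiv tEquiv S₂) {A B : H →ₗ.[ℂ] H}
    (hA : A.graph = closedGraph S₁) (hB : B.graph = closedGraph S₂) :
    ∃ E : SpectralMeasure (ℝ × ℝ) H, IsJointSpectralMeasure E A B := by
  -- The unitary `W` sends the class of `fn w` to `x w`: both families are total with Gram matrix
  -- given by `u`.
  obtain ⟨W, hW⟩ := exists_linearIsometryEquiv_of_inner_eq hμ.topologicalClosure_span_toLp hx.2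
    fun i j => by rw [hx.1, hμ.inner_toLp]
  have key : ∀ {φ : ℝ × ℝ → ℝ} (hφ : Measurable φ) {S : H →L[ℂ] H} {κ : MomentIndex ≃ MomentIndex},
      (∀ w, S (x (κ w)) = x w) → (∀ w p, (κ w).fn p = ((φ p : ℂ) + I) * w.fn p) →
      S = mulOp W _ (memLp_top_inv_add_I hφ) := by
    intro φ hφ S κ hS hfn
    refine ContinuousLinearMap.ext_of_total (total_comp_equiv hx.2 κ) fun w => ?_
    rw [hS, mulOp_apply, ← W.symm_apply_eq, ← hW w, ← hW (κ w), W.symm_apply_apply,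
      W.symm_apply_apply]
    refine Lp.ext ?_
    filter_upwards [coeFn_mulLp (memLp_top_inv_add_I hφ) (hμ.memLp_fn (κ w)).toLp,
      (hμ.memLp_fn (κ w)).coeFn_toLp, (hμ.memLp_fn w).coeFn_toLp] with p e1 e2 e3
    rw [e1, e2, e3, hfn, inv_mul_cancel_left₀ (ofReal_add_I_ne_zero _)]
  rw [key measurable_fst h₁.apply fn_incK] at hA
  rw [key measurable_snd h₂.apply fn_incR] at hB
  exact ⟨mulSpectralMeasure W, isIntegral_mulSpectralMeasure W measurable_fst hA,
    isIntegral_mulSpectralMeasure W measurable_snd hB⟩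

end IsRepresentingFamily

/-! ### From positivity to a separable Hilbert space. -/

namespace MomentPositive

variable {u : MomentIndex → ℂ}

theorem sum_nonneg (h : MomentPositive u) (α : MomentIndex →₀ ℂ) :
    0 ≤ α.sum fun w a => α.sum fun w' a' => a * conj a' * u (w.pair w') := h α

/-- Positivity includes reality of the form at `δ_w + c δ_v`. The value `c = 0` makes the diagonal
real, `c = 1` then fixes the imaginary parts off the diagonal and `c = i` the real parts. -/
theorem hermitian (h : MomentPositive u) (w v : MomentIndex) :
    u (v.pair w) = conj (u (w.pair v)) := by
  have key : ∀ w v : MomentIndex, ∀ c : ℂ, 0 ≤ u (w.pair w) + conj c * u (w.pair v) +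
      (c * u (v.pair w) + c * conj c * u (v.pair v)) := by
    intro w v c
    have := h.sum_nonneg (Finsupp.single w 1 + Finsupp.single v c)
    simp only [Finsupp.sum_add_index', Finsupp.sum_single_index, map_zero, map_add, map_one,
      zero_mul, mul_zero, mul_one, add_mul, mul_add, implies_true] at this
    rw [Finsupp.sum_add_index' (by simp) (by intros; ring)] at this
    simpa using this
  have h0 := fun w => (Complex.nonneg_iff.1 (key w w 0)).2
  have h1 := (Complex.nonneg_iff.1 (key w v 1)).2
  have h2 := (Complex.nonneg_iff.1 (key w v I)).2
  have hw := h0 w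
  have hv := h0 v
  simp at h1 h2 hw hv
  refine Complex.ext ?_ ?_
  · simp; linarith
  · simp; linarith

/-- The kernel of the moment form. -/
noncomputable def kernel (u : MomentIndex → ℂ) : Matrix MomentIndex MomentIndex (ℂ →L[ℂ] ℂ) :=
  fun w v => u (v.pair w) • 1

theorem posSemidef_kernel (h : MomentPositive u) : (kernel u).PosSemidef := by
  have htfae := (RKHS.posSemidef_tfae (K := kernel u)).out 0 2
  refine htfae.2 ⟨?_, fun α => ?_⟩
  · ext w v
    simp [kernel, Matrix.conjTranspose_apply, h.hermitian w v]
  · have := (Complex.nonneg_iff.1 (h.sum_nonneg α)).1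
    rw [Finsupp.sum_comm] at this
    convert this using 1
    simp only [RCLike.re_to_complex]
    congr 1
    refine Finsupp.sum_congr fun w _ => Finsupp.sum_congr fun v _ => ?_
    simp [kernel, h.hermitian v w]
    ring

end MomentPositive

instance : Countable MomentIndex :=
  Function.Injective.countable (f := fun w : MomentIndex => (w.m, w.k, w.l, w.n, w.r, w.t))
    fun w v h => by
      simp only [Prod.mk.injEq] at h
      ext <;> tauto

theorem IsRepresentingFamily.separableSpace {u : MomentIndex → ℂ} {H : Type*}
    [NormedAddCommGroup H] [InnerProductSpace ℂ H] {x : MomentIndex → H}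
    (hx : IsRepresentingFamily u x) : TopologicalSpace.SeparableSpace H := by
  rw [← TopologicalSpace.isSeparable_univ_iff]
  have h1 : TopologicalSpace.IsSeparable (Set.range x) := (Set.countable_range x).isSeparable
  have h2 := (h1.span (R := ℂ)).closure
  rwa [← Submodule.topologicalClosure_coe, hx.2] at h2

/-- The space is the reproducing kernel Hilbert space of the moment form, and `x_w` is the kernel
function at `w`. -/
theorem MomentPositive.exists_isRepresentingFamily {u : MomentIndex → ℂ} (h : MomentPositive u) :
    ∃ (H : Type) (_ : NormedAddCommGroup H) (_ : InnerProductSpace ℂ H) (_ : CompleteSpace H)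
      (x : MomentIndex → H), IsRepresentingFamily u x := by
  have : Fact (MomentPositive.kernel u).PosSemidef := ⟨h.posSemidef_kernel⟩
  let H := RKHS.OfKernel (MomentPositive.kernel u)
  refine ⟨H, inferInstance, inferInstance, inferInstance, fun w => RKHS.kerFun H w 1, ?_, ?_⟩
  · intro w v
    rw [← RKHS.kernel_inner, RKHS.OfKernel.kernel_ofKernel]
    simp [MomentPositive.kernel, h.hermitian w v]
  · rw [← RKHS.kerFun_dense H]
    congr 1
    apply le_antisymm
    · exact Submodule.span_mono (by rintro _ ⟨w, rfl⟩; exact ⟨w, 1, rfl⟩)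
    · rw [Submodule.span_le]
      rintro _ ⟨w, c, rfl⟩
      have : RKHS.kerFun H w c = c • RKHS.kerFun H w 1 := by rw [← map_smul, smul_eq_mul, mul_one]
      rw [this]
      exact Submodule.smul_mem _ _ (Submodule.subset_span ⟨w, rfl⟩)

/-! ### Gelfand duality and vector states as measures. -/

section GelfandModel

/-- Two commuting normal operators (which also commute with each other's adjoints) are
simultaneously represented by continuous functions on a compact Hausdorff space. -/
theorem exists_continuous_model.{v} {A : Type v} [CStarAlgebra A] (a b : A)
    (haa : a * star a = star a * a) (hbb : b * star b = star b * b) (hab : a * b = b * a)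
    (hab' : a * star b = star b * a) :
    ∃ (K : Type v) (_ : TopologicalSpace K) (_ : CompactSpace K) (_ : T2Space K)
      (f g : C(K, ℂ)) (Γ : C(K, ℂ) →⋆ₐ[ℂ] A),
      Function.Injective Γ ∧ Γ f = a ∧ Γ g = b := by
  have hba' : b * star a = star a * b := by
    have := congrArg star hab'
    simpa using this
  have hcomm := StarAlgebra.isMulCommutative_adjoin (s := {a, b}) ℂ
    (by rintro x (rfl | rfl) y (rfl | rfl) <;> first | rfl | exact hab | exact hab.symm)
    (by rintro x (rfl | rfl) y (rfl | rfl) <;> assumption)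
  -- The closed star algebra generated by `a` and `b` is commutative, so the Gelfand transform
  -- identifies it with the continuous functions on its character space.
  let s := (StarAlgebra.adjoin ℂ ({a, b} : Set A)).topologicalClosure
  have hs : IsClosed (s : Set A) := StarSubalgebra.isClosed_topologicalClosure _
  have hc : ∀ x y : s, x * y = y * x :=
    (StarSubalgebra.commRingTopologicalClosure (StarAlgebra.adjoin ℂ ({a, b} : Set A))
      fun x y => hcomm.is_comm.comm x y).mul_comm
  let _ : CommCStarAlgebra s :=
    { (StarSubalgebra.cstarAlgebra s : CStarAlgebra s) with mul_comm := hc }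
  have hmem : ∀ x ∈ ({a, b} : Set A), x ∈ s := fun x hx =>
    StarSubalgebra.le_topologicalClosure _ (StarAlgebra.subset_adjoin ℂ _ hx)
  let G := gelfandStarTransform s
  let Γ : C(WeakDual.characterSpace ℂ s, ℂ) →⋆ₐ[ℂ] A :=
    s.subtype.comp (G.symm : C(WeakDual.characterSpace ℂ s, ℂ) →⋆ₐ[ℂ] s)
  have hΓ : ∀ f, Γ f = (G.symm f : s) := fun _ => rfl
  refine ⟨WeakDual.characterSpace ℂ s, inferInstance, inferInstance, inferInstance,
    G ⟨a, hmem a (by simp)⟩, G ⟨b, hmem b (by simp)⟩, Γ, ?_, ?_, ?_⟩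
  · intro f g h
    exact G.symm.injective (Subtype.ext h)
  · rw [hΓ, StarAlgEquiv.symm_apply_apply]
  · rw [hΓ, StarAlgEquiv.symm_apply_apply]

variable {K : Type*} [TopologicalSpace K]

/-- A real continuous function as a complex one. -/
noncomputable def complexify (f : C(K, ℝ)) : C(K, ℂ) := ⟨fun p => (f p : ℂ), by fun_prop⟩

theorem star_complexify (f : C(K, ℝ)) : star (complexify f) = complexify f := by
  ext p; simp [complexify]

variable [CompactSpace K] [T2Space K] {H : Type*} [NormedAddCommGroup H]
  [InnerProductSpace ℂ H] [CompleteSpace H]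

/-- Vector states of a representation of `C(K, ℂ)` are integrals. -/
theorem exists_measure_of_representation [MeasurableSpace K] [BorelSpace K]
    (Γ : C(K, ℂ) →⋆ₐ[ℂ] (H →L[ℂ] H)) (h : H) :
    ∃ ρ : Measure K, IsFiniteMeasure ρ ∧ ∀ f : C(K, ℂ), ∫ p, f p ∂ρ = inner ℂ h (Γ f h) := by
  let L : CompactlySupportedContinuousMap K ℝ →ₗ[ℝ] ℝ :=
    { toFun := fun f => (inner ℂ h (Γ (complexify (f : C(K, ℝ))) h)).re
      map_add' := fun f g => by
        have : complexify ((f + g : CompactlySupportedContinuousMap K ℝ) : C(K, ℝ)) =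
            complexify (f : C(K, ℝ)) + complexify (g : C(K, ℝ)) := by
          ext p; simp [complexify]
        rw [this, map_add, add_apply, inner_add_right, Complex.add_re]
      map_smul' := fun c f => by
        have : complexify ((c • f : CompactlySupportedContinuousMap K ℝ) : C(K, ℝ)) =
            (c : ℂ) • complexify (f : C(K, ℝ)) := by
          ext p; simp [complexify]
        rw [this, map_smul, smul_apply, inner_smul_right, Complex.re_ofReal_mul]
        rfl }
  have hpos : ∀ f, 0 ≤ f → 0 ≤ L f := by
    intro f hf
    -- Writing `f = star g * g` with `g = √f` gives `(Γ f h, h) = ‖Γ g h‖² ≥ 0`.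
    let g : C(K, ℂ) := complexify ⟨fun p => √(f p), by fun_prop⟩
    have hg : complexify (f : C(K, ℝ)) = star g * g := by
      rw [star_complexify]
      ext p
      simp only [complexify, g, ContinuousMap.mul_apply, ContinuousMap.coe_mk]
      rw [← Complex.ofReal_mul, Real.mul_self_sqrt (hf p)]
    change 0 ≤ (inner ℂ h (Γ (complexify (f : C(K, ℝ))) h)).re
    rw [hg, map_mul, map_star, mul_apply_eq_comp, ContinuousLinearMap.star_eq_adjoint,
      ContinuousLinearMap.adjoint_inner_right, ← RCLike.re_to_complex, inner_self_eq_norm_sq]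
    positivity
  let Λ := PositiveLinearMap.mk₀ L hpos
  let ρ := RealRMK.rieszMeasure Λ
  have hreal : ∀ f : C(K, ℝ), ∫ p, ((f p : ℝ) : ℂ) ∂ρ = inner ℂ h (Γ (complexify f) h) := by
    intro f
    have h1 := RealRMK.integral_rieszMeasure Λ (CompactlySupportedContinuousMap.continuousMapEquiv f)
    rw [integral_complex_ofReal]
    have h2 : ∫ p, f p ∂ρ = (inner ℂ h (Γ (complexify f) h)).re := h1
    rw [h2]
    refine Complex.ext rfl ?_
    rw [Complex.ofReal_im, Eq.comm, ← Complex.conj_eq_iff_im, inner_conj_symm,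
      ← ContinuousLinearMap.adjoint_inner_right, ← ContinuousLinearMap.star_eq_adjoint, ← map_star,
      star_complexify]
  have hfin : IsFiniteMeasure ρ := ⟨isCompact_univ.measure_lt_top⟩
  refine ⟨ρ, hfin, fun f => ?_⟩
  let fr : C(K, ℝ) := ⟨fun p => (f p).re, by fun_prop⟩
  let fi : C(K, ℝ) := ⟨fun p => (f p).im, by fun_prop⟩
  have hf : f = complexify fr + I • complexify fi := by
    ext p
    simp [complexify, fr, fi, mul_comm I, Complex.re_add_im]
  have hint : ∀ g : C(K, ℂ), Integrable g ρ := fun g =>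
    g.continuous.integrable_of_hasCompactSupport (HasCompactSupport.of_compactSpace _)
  have h1 : ∫ p, f p ∂ρ = ∫ p, ((fr p : ℝ) : ℂ) ∂ρ + I * ∫ p, ((fi p : ℝ) : ℂ) ∂ρ := by
    have ir : Integrable (fun p => ((fr p : ℝ) : ℂ)) ρ := hint (complexify fr)
    have ii : Integrable (fun p => I * ((fi p : ℝ) : ℂ)) ρ := (hint (complexify fi)).const_mul I
    rw [← integral_const_mul, ← integral_add ir ii]
    refine integral_congr_ae (.of_forall fun p => ?_)
    have := congrArg (fun g : C(K, ℂ) => g p) hf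
    simpa [complexify] using this
  rw [h1, hreal, hreal, hf, map_add, map_smul, add_apply, smul_apply, inner_add_right,
    inner_smul_right]

end GelfandModel

/-! ### The compact model in the variables `(xⱼ + i)⁻¹`. -/

section Existence

/-- The monomials in two complex variables and their conjugates. -/
noncomputable def monomial₂ (a b c d : ℕ) (z : ℂ × ℂ) : ℂ :=
  z.1 ^ a * conj z.1 ^ b * (z.2 ^ c * conj z.2 ^ d)

/-- The compact model of the moment problem in the variables `zⱼ = (xⱼ + i)⁻¹`: measures `ν N` with
density `|z₁ z₂| ^ (-2 N)` with respect to `ν 0`. -/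
structure InverseModel (u : MomentIndex → ℂ) (ν : ℕ → Measure (ℂ × ℂ)) : Prop where
  finite : ∀ N, IsFiniteMeasure (ν N)
  ae_fst : ∀ N, ∀ᵐ z ∂(ν N), conj z.1 - z.1 = 2 * I * (z.1 * conj z.1)
  ae_snd : ∀ N, ∀ᵐ z ∂(ν N), conj z.2 - z.2 = 2 * I * (z.2 * conj z.2)
  integrable : ∀ N a b c d, Integrable (monomial₂ a b c d) (ν N)
  integral : ∀ (N a b c d : ℕ), ∫ z, monomial₂ a b c d z ∂(ν N) =
    u ⟨0, N - a, N - b, 0, N - c, N - d⟩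
  density : ∀ N, ν 0 = normSqMeasure (ν N) fun z => (z.1 * z.2) ^ N

theorem commute_of_shift {ι H : Type*} [NormedAddCommGroup H] [InnerProductSpace ℂ H] {x : ι → H}
    (hx : (Submodule.span ℂ (Set.range x)).topologicalClosure = ⊤) {S T : H →L[ℂ] H}
    {e f : ι ≃ ι} (hS : ∀ w, S (x (e w)) = x w) (hT : ∀ w, T (x (f w)) = x w)
    (hef : ∀ w, e (f w) = f (e w)) : S * T = T * S := by
  refine ContinuousLinearMap.ext_of_total (total_comp_equiv (total_comp_equiv hx f) e) fun w => ?_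
  rw [mul_apply_eq_comp, mul_apply_eq_comp, hT, hS, ← hef, hS, hT]

theorem pow_apply_of_shift {ι H : Type*} [NormedAddCommGroup H] [InnerProductSpace ℂ H]
    {x : ι → H} {S : H →L[ℂ] H} {e : ι → ι} {f : ℕ → ι} (hS : ∀ w, S (x (e w)) = x w)
    (hf : ∀ n, e (f (n + 1)) = f n) (n : ℕ) : (S ^ n) (x (f 0)) = x (f n) := by
  induction n with
  | zero => simp
  | succ n hn =>
    rw [pow_succ', mul_apply_eq_comp, hn, ← hf, hS]

/-- Let `f₁, f₂` be the functions representing `S₁, S₂`. Then `ν N` is the image under `(f₁, f₂)` of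
the measure of the vector state at `x (v N)`, which formally stands for `(x₁ + i)^N (x₂ + i)^N`.
Applying powers of the `Sⱼ` and their adjoints lowers exponents, which gives the integrals; `S₁^N
S₂^N` maps `x (v N)` to `x (v 0)`, which gives the density relation. -/
theorem exists_inverseModel {u : MomentIndex → ℂ} {H : Type*} [NormedAddCommGroup H]
    [InnerProductSpace ℂ H] [CompleteSpace H] {x : MomentIndex → H}
    (hx : IsRepresentingFamily u x) (hu : MomentRecurrences u) :
    ∃ ν : ℕ → Measure (ℂ × ℂ), InverseModel u ν := by
  obtain ⟨S₁, h₁⟩ := hx.exists_resolvent_fst hu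
  obtain ⟨S₂, h₂⟩ := hx.exists_resolvent_snd hu
  obtain ⟨K, _, _, _, f₁, f₂, Γ, hΓ, hf₁, hf₂⟩ := exists_continuous_model S₁ S₂
    (commute_of_shift hx.2 h₁.apply h₁.adjoint_apply fun _ => rfl)
    (commute_of_shift hx.2 h₂.apply h₂.adjoint_apply fun _ => rfl)
    (commute_of_shift hx.2 h₁.apply h₂.apply fun _ => rfl)
    (commute_of_shift hx.2 h₁.apply h₂.adjoint_apply fun _ => rfl)
  let _ : MeasurableSpace K := borel K
  have _ : BorelSpace K := ⟨rfl⟩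
  let v : ℕ → MomentIndex := fun N => ⟨0, N, 0, 0, N, 0⟩
  choose ρ hρfin hρ using fun N => exists_measure_of_representation Γ (x (v N))
  let F : K → ℂ × ℂ := fun p => (f₁ p, f₂ p)
  have hFc : Continuous F := by fun_prop
  have hFm : Measurable F := hFc.measurable
  have hrel : ∀ {f : C(K, ℂ)} {S : H →L[ℂ] H}, Γ f = S →
      (∀ a, ContinuousLinearMap.adjoint S a - S a = (2 * I) • S (ContinuousLinearMap.adjoint S a)) →
      ∀ p, conj (f p) - f p = 2 * I * (f p * conj (f p)) := by
    intro f S hf hS p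
    have h1 : star f - f = (2 * I) • (f * star f) := by
      apply hΓ
      rw [map_sub, map_smul, map_mul, map_star, hf]
      ext a
      exact hS a
    have := congrArg (fun g : C(K, ℂ) => g p) h1
    simpa using this
  have hrel₁ := hrel hf₁ h₁.adjoint_sub
  have hrel₂ := hrel hf₂ h₂.adjoint_sub
  have hmon : ∀ a b c d : ℕ, Continuous (monomial₂ a b c d) := by
    intro a b c d; unfold monomial₂; fun_prop
  have hmono : ∀ (N a b c d : ℕ), Γ (f₁ ^ a * star f₁ ^ b * (f₂ ^ c * star f₂ ^ d)) (x (v N)) =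
      x ⟨0, N - a, -b, 0, N - c, -d⟩ := by
    intro N a b c d
    simp only [map_mul, map_pow, map_star, hf₁, hf₂, mul_apply_eq_comp,
      ContinuousLinearMap.star_eq_adjoint]
    have e4 := pow_apply_of_shift (f := fun n : ℕ => ⟨0, N, 0, 0, N, -n⟩)
      h₂.adjoint_apply (by intro n; ext <;> simp [tEquiv, incT]) d
    have e3 := pow_apply_of_shift (f := fun n : ℕ => ⟨0, N, 0, 0, N - n, -d⟩)
      h₂.apply (by intro n; ext <;> simp [rEquiv, incR]; ring) c
    have e2 := pow_apply_of_shift (f := fun n : ℕ => ⟨0, N, -n, 0, N - c, -d⟩)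
      h₁.adjoint_apply (by intro n; ext <;> simp [lEquiv, incL]) b
    have e1 := pow_apply_of_shift (f := fun n : ℕ => ⟨0, N - n, -b, 0, N - c, -d⟩)
      h₁.apply (by intro n; ext <;> simp [kEquiv, incK]; ring) a
    simp only [Nat.cast_zero, neg_zero, sub_zero] at e1 e2 e3 e4
    rw [e4, e3, e2, e1]
  have hImon : ∀ N a b c d, Integrable (monomial₂ a b c d) ((ρ N).map F) := by
    intro N a b c d
    rw [integrable_map_measure (hmon a b c d).aestronglyMeasurable hFm.aemeasurable]
    exact ((hmon a b c d).comp hFc).integrable_of_hasCompactSupport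
      (HasCompactSupport.of_compactSpace _)
  refine ⟨fun N => (ρ N).map F, fun N => ?_, fun N => ?_, fun N => ?_, fun N a b c d => ?_,
    fun N a b c d => ?_, fun N => ?_⟩
  · exact Measure.isFiniteMeasure_map _ _
  · rw [ae_map_iff hFm.aemeasurable]
    · exact .of_forall hrel₁
    · exact (isClosed_eq (by fun_prop) (by fun_prop)).measurableSet
  · rw [ae_map_iff hFm.aemeasurable]
    · exact .of_forall hrel₂
    · exact (isClosed_eq (by fun_prop) (by fun_prop)).measurableSet
  · exact hImon N a b c d
  · rw [integral_map hFm.aemeasurable (hmon a b c d).aestronglyMeasurable]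
    have := hρ N (f₁ ^ a * star f₁ ^ b * (f₂ ^ c * star f₂ ^ d))
    rw [hmono, hx.1] at this
    refine Eq.trans ?_ (this.trans (congrArg u ?_))
    · refine integral_congr_ae (.of_forall fun p => ?_)
      simp [monomial₂, F]
    · ext <;> simp [pair, v] <;> ring
  · have hm : Measurable fun z : ℂ × ℂ => (z.1 * z.2) ^ N := by fun_prop
    have hfin : IsFiniteMeasure (normSqMeasure ((ρ N).map F) fun z => (z.1 * z.2) ^ N) := by
      refine isFiniteMeasure_withDensity ?_
      have h1 := (hImon N N N N N).2.ne
      convert h1 using 1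
      refine lintegral_congr fun z => ?_
      rw [enorm_eq_nnnorm]
      congr 1
      simp only [monomial₂, nnnorm_pow, nnnorm_mul, RCLike.nnnorm_conj]
      ring
    -- The two measures are compared on bounded continuous functions, using `(Γ(conj q * G * q) x_N,
    -- x_N) = (Γ(G) x_0, x_0)` for `q = f₁^N f₂^N`, where `x_N = x (v N)`.
    refine ext_of_forall_integral_eq_of_IsFiniteMeasure fun g => ?_
    rw [integral_normSqMeasure hm.aestronglyMeasurable,
      integral_map hFm.aemeasurable g.continuous.aestronglyMeasurable,
      integral_map hFm.aemeasurable (by fun_prop)]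
    apply Complex.ofReal_injective
    rw [← integral_complex_ofReal, ← integral_complex_ofReal]
    let G : C(K, ℂ) := ⟨fun p => (g (F p) : ℂ), by fun_prop⟩
    let q : C(K, ℂ) := f₁ ^ N * f₂ ^ N
    have hq : Γ q (x (v N)) = x (v 0) := by
      have := hmono N N 0 N 0
      simp only [pow_zero, mul_one, sub_self, Nat.cast_zero, neg_zero] at this
      exact this
    have h0 := hρ 0 G
    have hN := hρ N (star q * G * q)
    rw [map_mul, map_mul, map_star, mul_apply_eq_comp, mul_apply_eq_comp, hq,
      ContinuousLinearMap.star_eq_adjoint, ContinuousLinearMap.adjoint_inner_right, hq] at hN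
    refine h0.trans (hN.symm.trans (integral_congr_ae (.of_forall fun p => ?_)))
    simp only [G, q, F, ContinuousMap.mul_apply, ContinuousMap.star_apply, ContinuousMap.pow_apply,
      ContinuousMap.coe_mk, smul_eq_mul]
    push_cast
    rw [← Complex.conj_mul', mul_pow]
    simp only [RCLike.star_def]
    ring

end Existence

/-! ### From the compact model to a solution on the plane. -/

section Existence

/-- The real coordinate `x` of a point `z = (x + i)⁻¹`. -/
theorem ofReal_inv_re_add_I {z : ℂ} (hz : z ≠ 0) (h : conj z - z = 2 * I * (z * conj z)) :
    (((z⁻¹).re : ℝ) : ℂ) + I = z⁻¹ ∧ (((z⁻¹).re : ℝ) : ℂ) - I = (conj z)⁻¹ := by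
  have hz' : conj z ≠ 0 := by simpa using hz
  have h1 : z⁻¹ - (conj z)⁻¹ = 2 * I := by
    rw [inv_sub_inv hz hz', h]; field_simp
  have h2 : (((z⁻¹).re : ℝ) : ℂ) = (z⁻¹ + (conj z)⁻¹) / 2 := by
    rw [Complex.re_eq_add_conj, map_inv₀]
  rw [h2]
  constructor
  · linear_combination (-1 / 2 : ℂ) * h1
  · linear_combination (1 / 2 : ℂ) * h1

theorem normSq_pow_mul_zpow {z : ℂ} (hz : z ≠ 0) {N : ℕ} {a b : ℕ} {k l : ℤ}
    (ha : (a : ℤ) = N - k) (hb : (b : ℤ) = N - l) :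
    (z ^ N * conj z ^ N) * ((z⁻¹) ^ k * ((conj z)⁻¹) ^ l) = z ^ a * conj z ^ b := by
  have hz' : conj z ≠ 0 := by simpa using hz
  rw [← zpow_natCast z a, ← zpow_natCast (conj z) b, ha, hb, zpow_sub₀ hz, zpow_sub₀ hz',
    inv_zpow, inv_zpow, zpow_natCast, zpow_natCast]
  field_simp

/-- The measure on the plane given by the compact model. -/
noncomputable def planeMeasure (ν : ℕ → Measure (ℂ × ℂ)) : Measure (ℝ × ℝ) :=
  (ν 0).map fun z => ((z.1⁻¹).re, (z.2⁻¹).re)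

/-- For `N` beyond all exponents, the density `|z₁ z₂|^(2N)` of `ν 0` relative to `ν N` absorbs the
poles of `fn` at `zⱼ = 0` and leaves a monomial whose integral is known. -/
theorem InverseModel.integral_fn {u : MomentIndex → ℂ} {ν : ℕ → Measure (ℂ × ℂ)}
    (h : InverseModel u ν) (k l r t : ℤ) :
    Integrable (fn ⟨0, k, l, 0, r, t⟩) (planeMeasure ν) ∧
      ∫ p, fn ⟨0, k, l, 0, r, t⟩ p ∂(planeMeasure ν) = u ⟨0, k, l, 0, r, t⟩ := by
  have hX : Measurable fun z : ℂ × ℂ => ((z.1⁻¹).re, (z.2⁻¹).re) := by fun_prop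
  -- Strictness makes `a` and `c` positive, and `N ≠ 0`; hence both sides of `key` vanish where some
  -- `zⱼ = 0`, whatever value the convention `0⁻¹ = 0` gives to `fn` there.
  obtain ⟨N, hN, hk, hl, hr, ht⟩ : ∃ N : ℕ, N ≠ 0 ∧ k < N ∧ l < N ∧ r < N ∧ t < N :=
    ⟨k.natAbs + l.natAbs + r.natAbs + t.natAbs + 1, by omega, by omega, by omega, by omega, by omega⟩
  obtain ⟨a, ha⟩ := Int.eq_ofNat_of_zero_le (sub_nonneg.2 hk.le)
  obtain ⟨b, hb⟩ := Int.eq_ofNat_of_zero_le (sub_nonneg.2 hl.le)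
  obtain ⟨c, hc⟩ := Int.eq_ofNat_of_zero_le (sub_nonneg.2 hr.le)
  obtain ⟨d, hd⟩ := Int.eq_ofNat_of_zero_le (sub_nonneg.2 ht.le)
  have ha0 : a ≠ 0 := by omega
  have hc0 : c ≠ 0 := by omega
  have key : ∀ᵐ z ∂(ν N), ‖(z.1 * z.2) ^ N‖ ^ 2 •
      fn ⟨0, k, l, 0, r, t⟩ ((z.1⁻¹).re, (z.2⁻¹).re) = monomial₂ a b c d z := by
    filter_upwards [h.ae_fst N, h.ae_snd N] with z h1 h2
    have e : ∀ w : ℂ, ‖(z.1 * z.2) ^ N‖ ^ 2 • w =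
        (z.1 ^ N * conj z.1 ^ N) * (z.2 ^ N * conj z.2 ^ N) * w := by
      intro w
      rw [Complex.real_smul]
      push_cast
      rw [← Complex.mul_conj', map_pow, map_mul]
      ring
    by_cases hz1 : z.1 = 0
    · rw [e]; simp [monomial₂, hz1, hN, ha0]
    by_cases hz2 : z.2 = 0
    · rw [e]; simp [monomial₂, hz2, hN, hc0]
    obtain ⟨p1, p2⟩ := ofReal_inv_re_add_I hz1 h1
    obtain ⟨q1, q2⟩ := ofReal_inv_re_add_I hz2 h2
    rw [e, fn, p1, p2, q1, q2, pow_zero, pow_zero, one_mul, one_mul, mul_mul_mul_comm,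
      normSq_pow_mul_zpow hz1 ha.symm hb.symm, normSq_pow_mul_zpow hz2 hc.symm hd.symm]
    rfl
  have hm : Measurable fun z : ℂ × ℂ => (z.1 * z.2) ^ N := by fun_prop
  have hfn := (continuous_fn ⟨0, k, l, 0, r, t⟩).aestronglyMeasurable (μ := planeMeasure ν)
  constructor
  · rw [planeMeasure, integrable_map_measure hfn hX.aemeasurable, h.density N, normSqMeasure,
      integrable_withDensity_iff_integrable_smul₀ (hm.nnnorm.pow_const 2).aemeasurable]
    exact (h.integrable N a b c d).congr (key.mono fun z hz => hz.symm)
  · rw [planeMeasure, integral_map hX.aemeasurable hfn, h.density N,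
      integral_normSqMeasure hm.aestronglyMeasurable, integral_congr_ae key, h.integral]
    congr 1
    ext <;> simp <;> omega

/-- Powers of `xⱼ` are removed by `xⱼ = (xⱼ + i) - i`, mirrored on `u` by the recurrences. Each
removal may raise `k` or `r`, so these stay general in the inductions. -/
theorem InverseModel.isMomentSolution {u : MomentIndex → ℂ} {ν : ℕ → Measure (ℂ × ℂ)}
    (h : InverseModel u ν) (hu : MomentRecurrences u) : IsMomentSolution u (planeMeasure ν) := by
  have hz : ∀ w : MomentIndex, w.pair zero = w := by intro w; ext <;> simp [pair, zero]
  have step : ∀ {w v w' : MomentIndex} {c : ℂ}, (∀ p, w'.fn p = w.fn p - c * v.fn p) →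
      u w' = u w - c * u v →
      (Integrable w.fn (planeMeasure ν) ∧ ∫ p, w.fn p ∂(planeMeasure ν) = u w) →
      (Integrable v.fn (planeMeasure ν) ∧ ∫ p, v.fn p ∂(planeMeasure ν) = u v) →
      Integrable w'.fn (planeMeasure ν) ∧ ∫ p, w'.fn p ∂(planeMeasure ν) = u w' := by
    intro w v w' c hf hu' hw hv
    have hi : Integrable (fun p => c * v.fn p) (planeMeasure ν) := hv.1.const_mul c
    rw [funext hf]
    refine ⟨hw.1.sub hi, ?_⟩
    rw [integral_sub hw.1 hi, integral_const_mul, hw.2, hv.2, hu']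
  rintro ⟨m, k, l, n, r, t⟩
  induction n generalizing r with
  | zero =>
    induction m generalizing k with
    | zero => exact h.integral_fn k l r t
    | succ m hm =>
      refine step (c := I) (fun p => ?_) ?_ (hm (k + 1)) (hm k)
      · have h1 := fn_incM ⟨m, k, l, 0, r, t⟩ p
        have h2 := fn_incK ⟨m, k, l, 0, r, t⟩ p
        exact h1.trans (eq_sub_of_add_eq (by rw [← add_mul]; exact h2.symm))
      · have := hu.rec_k ⟨m, k, l, 0, r, t⟩ zero
        rw [hz, hz, hz] at this
        exact eq_sub_of_add_eq this
  | succ n hn =>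
    refine step (c := I) (fun p => ?_) ?_ (hn (r + 1)) (hn r)
    · have h1 := fn_incN ⟨m, k, l, n, r, t⟩ p
      have h2 := fn_incR ⟨m, k, l, n, r, t⟩ p
      exact h1.trans (eq_sub_of_add_eq (by rw [← add_mul]; exact h2.symm))
    · have := hu.rec_r ⟨m, k, l, n, r, t⟩ zero
      rw [hz, hz, hz] at this
      exact eq_sub_of_add_eq this

theorem MomentPositive.exists_isMomentSolution {u : MomentIndex → ℂ} (hp : MomentPositive u)
    (hu : MomentRecurrences u) : ∃ μ : Measure (ℝ × ℝ), IsMomentSolution u μ := by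
  obtain ⟨H, _, _, _, x, hx⟩ := hp.exists_isRepresentingFamily
  obtain ⟨ν, hν⟩ := exists_inverseModel hx hu
  exact ⟨planeMeasure ν, hν.isMomentSolution hu⟩

end Existence

theorem theorem2 (u : MomentIndex → ℂ) :
    ((∃ μ : Measure (ℝ × ℝ), IsMomentSolution u μ) ↔ MomentPositive u ∧ MomentRecurrences u) ∧
    (MomentPositive u → MomentRecurrences u →
      -- there is exactly one solution `μ`
      ∃ μ : Measure (ℝ × ℝ), IsMomentSolution u μ ∧
        (∀ μ' : Measure (ℝ × ℝ), IsMomentSolution u μ' → μ' = μ) ∧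
        -- a separable Hilbert space with a representing family exists
        (∃ (H : Type) (_ : NormedAddCommGroup H) (_ : InnerProductSpace ℂ H)
          (_ : CompleteSpace H) (_ : TopologicalSpace.SeparableSpace H) (x : MomentIndex → H),
          IsRepresentingFamily u x) ∧
        -- and, whichever is chosen, the construction through the operators yields `μ`
        ∀ (H : Type*) [NormedAddCommGroup H] [InnerProductSpace ℂ H] [CompleteSpace H]
          (x : MomentIndex → H), IsRepresentingFamily u x →
          ∃ A₀ B₀ : H →ₗ.[ℂ] H,
            IsShiftOperator x MomentIndex.incM A₀ ∧ IsShiftOperator x MomentIndex.incN B₀ ∧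
            A₀.IsClosable ∧ B₀.IsClosable ∧
            IsSelfAdjoint A₀.closure ∧ IsSelfAdjoint B₀.closure ∧
            SpectrallyCommute A₀.closure B₀.closure ∧
            (∃ E : SpectralMeasure (ℝ × ℝ) H,
              IsJointSpectralMeasure E A₀.closure B₀.closure) ∧
            ∀ E : SpectralMeasure (ℝ × ℝ) H,
              IsJointSpectralMeasure E A₀.closure B₀.closure →
                μ = E.scalarMeasure (x MomentIndex.zero)) := by
  refine ⟨⟨fun ⟨μ, hμ⟩ => ⟨hμ.momentPositive, hμ.momentRecurrences⟩,
    fun ⟨hp, hu⟩ => hp.exists_isMomentSolution hu⟩, fun hp hu => ?_⟩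
  obtain ⟨μ, hμ⟩ := hp.exists_isMomentSolution hu
  refine ⟨μ, hμ, fun μ' hμ' => hμ'.unique hμ, ?_, ?_⟩
  · obtain ⟨H, i₁, i₂, i₃, x, hx⟩ := hp.exists_isRepresentingFamily
    exact ⟨H, i₁, i₂, i₃, hx.separableSpace, x, hx⟩
  · intro H _ _ _ x hx
    obtain ⟨S₁, h₁⟩ := hx.exists_resolvent_fst hu
    obtain ⟨S₂, h₂⟩ := hx.exists_resolvent_snd hu
    obtain ⟨A, hA, hAc, hAg, hAs⟩ := h₁.exists_shift_operator
    obtain ⟨B, hB, hBc, hBg, hBs⟩ := h₂.exists_shift_operator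
    -- The solution `μ`, already constructed independently of this `H`, supplies the joint spectral
    -- measure; no spectral theorem for `A` and `B` is invoked.
    obtain ⟨E, hE⟩ := hx.exists_isJointSpectralMeasure hμ h₁ h₂ hAg hBg
    exact ⟨A, B, hA, hB, hAc, hBc, hAs, hBs, hE.spectrallyCommute, ⟨E, hE⟩, fun E' hE' =>
      hμ.unique (hx.isMomentSolution_scalarMeasure h₁ h₂ hAg hBg hE')⟩
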